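/- Let $U$ be a real separable Hilbert space and let $\Lambda:D(\Lambda)\subset U\to U$ be a positive self-adjoint operator which has a trace class inverse $\Lambda^{-1}:U\to U$. Let $V=D(\Lambda^{1/2})$ with inner product $\langle\Lambda^{1/2}x,\Lambda^{1/2}y\rangle_U$, let $V'$ be its dual space, embed $U\subset V'$ by $u\mapsto\langle u,\cdot\rangle_U$, extend $\Lambda$ to the operator on $V'$ with domain $V$ given by $(\Lambda v)(w)=\langle v,w\rangle_V$, and let $H=U\times V'$ with the Hilbert norm $\|(x_1,x_2)\|_H^2=\|x_1\|_U^2+\|x_2\|_{V'}^2$. Let $\rho>0$ and $\alpha\in[0,1)$, and assume that $\rho^2\neq 4\mu^{1-2\alpha}$ for every eigenvalue $\mu$ of $\Lambda$. Let $$\mathcal A_{\alpha,\rho}(x_1,x_2)=(x_2,\,-\Lambda x_1-\rho\Lambda^\alpha x_2),\qquad D(\mathcal A_{\alpha,\rho})=\{(x_1,x_2)\in H:\ x_1\in V,\ x_2\in U\cap D(\Lambda^\alpha)\},$$ where $\Lambda^\alpha$ is the power of the extended operator on $V'$, and let $G:U\to H$, $Gu=(0,u)$. Then (the closure of) $\mathcal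 A_{\alpha,\rho}$ generates a strongly continuous semigroup $(e^{t\mathcal A_{\alpha,\rho}})_{t\ge0}$ on $H$, and the following holds, where $\|\cdot\|_{L_2(U,H)}$ is the Hilbert--Schmidt norm. 1. $\displaystyle\sup_{t\ge0}\|e^{t\mathcal A_{\alpha,\rho}}G\|_{L_2(U,H)}<\infty$. 2. Consequently $\displaystyle\int_0^T t^{-2\gamma}\,\|e^{t\mathcal A_{\alpha,\rho}}G\|^2_{L_2(U,H)}\,dt<\infty$ for all $T>0$ and $\gamma\in(0,\tfrac12)$. 3. Consequently the stochastic convolution of the linear equation $dX_t=\mathcal A_{\alpha,\rho}X_t\,dt+G\,dW_t$ is well defined in $H$: for every cylindrical Wiener process $W$ on $U$, defined on any probability space $(\Omega,\mathcal F,\mathbb P)$, and every $t\ge0$, the stochastic integral $\int_0^t e^{(t-s)\mathcal A_{\alpha,\rho}}G\,dW_s$ (the $L^2(\Omega;H)$-limit of the integrals of elementary integrands which approximate $s\mapsto e^{(t-s)\mathcal A_{\alpha,\rho}}G$ in $L^2((0,t];L_2(U,H))$) exists and is unique up to $\mathbb P$-null sets. -/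

import Mathlib

open Set Filter Topology MeasureTheory ProbabilityTheory
open scoped NNReal ENNReal InnerProductSpace

noncomputable section

namespace DampedWave

/-! ### Operators: trace class, Hilbert-Schmidt norm, eigenspaces, fractional powers -/

section Operators

variable {E F : Type*} [NormedAddCommGroup E] [InnerProductSpace ℝ E]

/-- Trace class (nuclear) operators: `T x = ∑ ⟪a n, x⟫ b n` with `∑ ‖a n‖ ‖b n‖ < ∞`. -/
def IsTraceClass (T : E →L[ℝ] E) : Prop :=
  ∃ a b : ℕ → E, Summable (fun n => ‖a n‖ * ‖b n‖) ∧
    ∀ x, HasSum (fun n => ⟪a n, x⟫_ℝ • b n) (T x)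

/-- `K` is the (everywhere defined, bounded) inverse of the unbounded operator `L`. -/
def IsInverse (L : E →ₗ.[ℝ] E) (K : E →L[ℝ] E) : Prop :=
  (∀ x : L.domain, K (L x) = x) ∧ ∀ y : E, ∃ h : K y ∈ L.domain, L ⟨K y, h⟩ = y

/-- Positive self-adjoint operators which have a trace class inverse. -/
structure IsAdmissible [CompleteSpace E] (L : E →ₗ.[ℝ] E) : Prop where
  selfAdjoint : IsSelfAdjoint L
  nonneg : ∀ x : L.domain, 0 ≤ ⟪L x, (x : E)⟫_ℝ
  inverse : ∃ K : E →L[ℝ] E, IsInverse L K ∧ IsTraceClass K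

/-- The eigenspace `{x ∈ D(L) : L x = m x}`. -/
def eigenspace (L : E →ₗ.[ℝ] E) (m : ℝ) : Submodule ℝ E where
  carrier := {x | ∃ h : x ∈ L.domain, L ⟨x, h⟩ = m • x}
  zero_mem' := ⟨L.domain.zero_mem, by
    have : (⟨0, L.domain.zero_mem⟩ : L.domain) = 0 := rfl
    rw [this, L.map_zero, smul_zero]⟩
  add_mem' := by
    rintro x y ⟨hx, hx'⟩ ⟨hy, hy'⟩
    refine ⟨L.domain.add_mem hx hy, ?_⟩
    have : (⟨x + y, L.domain.add_mem hx hy⟩ : L.domain) = ⟨x, hx⟩ + ⟨y, hy⟩ := rfl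
    rw [this, L.map_add, hx', hy', smul_add]
  smul_mem' := by
    rintro c x ⟨hx, hx'⟩
    refine ⟨L.domain.smul_mem c hx, ?_⟩
    have : (⟨c • x, L.domain.smul_mem c hx⟩ : L.domain) = c • ⟨x, hx⟩ := rfl
    rw [this, L.map_smul, hx', smul_comm]

/-- `m` is an eigenvalue of `L`. -/
def IsEigenvalue (L : E →ₗ.[ℝ] E) (m : ℝ) : Prop := eigenspace L m ≠ ⊥

/-- The orthogonal projection onto the eigenspace of `m`. The eigenspaces of a self-adjoint
operator are closed, so that the closure changes nothing there. -/
def eigenproj [CompleteSpace E] (L : E →ₗ.[ℝ] E) (m : ℝ) : E →L[ℝ] E :=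
  (eigenspace L m).topologicalClosure.starProjection

/-- The power `L ^ s` of a positive self-adjoint operator whose eigenvectors are complete, through
its spectral decomposition: `L ^ s x = ∑ m ^ s P_m x`, the sum being over the eigenvalues `m` of `L`
(`P_m = 0` for the other `m`), with the set of all `x` for which this series
converges as its domain. The terms are mutually orthogonal, so that this
is the condition `∑ m ^ (2 s) ‖P_m x‖ ^ 2 < ∞`. -/
def fracPow [CompleteSpace E] (L : E →ₗ.[ℝ] E) (s : ℝ) : E →ₗ.[ℝ] E where
  domain :=
    { carrier := {x | Summable fun m : ℝ => m ^ s • eigenproj L m x}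
      zero_mem' := by simp [summable_zero]
      add_mem' := by
        intro x y hx hy
        simpa only [mem_ofPred_eq, map_add, smul_add] using Summable.add hx hy
      smul_mem' := by
        intro c x hx
        have h := Summable.const_smul c hx
        simp only [mem_ofPred_eq, map_smul]
        refine h.congr fun m => ?_
        rw [smul_comm] }
  toFun :=
    { toFun := fun x => ∑' m : ℝ, m ^ s • eigenproj L m (x : E)
      map_add' := by
        rintro ⟨x, hx⟩ ⟨y, hy⟩
        simp only [Submodule.coe_add, map_add, smul_add]
        exact Summable.tsum_add hx hy
      map_smul' := by
        rintro c ⟨x, hx⟩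
        simp only [Submodule.coe_smul, map_smul, RingHom.id_apply]
        rw [← Summable.tsum_const_smul c hx]
        exact tsum_congr fun m => smul_comm _ _ _ }

/-- The Hilbert-Schmidt norm `(∑ ‖T e_i‖ ^ 2) ^ (1/2)`, with `(e_i)` an
orthonormal basis; it is `∞` if `T` is not a Hilbert-Schmidt operator. It does not depend on the
basis, see `hsNorm_eq`. -/
def hsNorm [CompleteSpace E] [NormedAddCommGroup F] [NormedSpace ℝ F] (T : E →L[ℝ] F) : ℝ≥0∞ :=
  (∑' i : (exists_hilbertBasis ℝ E).choose,
    ‖T ((exists_hilbertBasis ℝ E).choose_spec.choose i)‖ₑ ^ 2) ^ (1 / 2 : ℝ)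

lemma enorm_sq_eq_tsum {ι : Type*} (b : HilbertBasis ι ℝ E) (x : E) :
    ‖x‖ₑ ^ 2 = ∑' i, ‖⟪b i, x⟫_ℝ‖ₑ ^ 2 := by
  have h := b.hasSum_inner_mul_inner x x
  have h2 : HasSum (fun i => ‖⟪b i, x⟫_ℝ‖ ^ 2) (‖x‖ ^ 2) := by
    rw [← real_inner_self_eq_norm_sq]
    refine h.congr_fun ?_ |> id
    intro i
    rw [real_inner_comm x (b i), Real.norm_eq_abs, sq_abs, sq]
  have e : ∀ {G : Type _} [NormedAddCommGroup G] (y : G), ‖y‖ₑ ^ 2 = ENNReal.ofReal (‖y‖ ^ 2) := by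
    intro G _ y
    rw [ENNReal.ofReal_pow (norm_nonneg _), ofReal_norm]
  rw [e x, ← h2.tsum_eq, ENNReal.ofReal_tsum_of_nonneg (fun _ => sq_nonneg _) h2.summable]
  refine tsum_congr fun i => ?_
  rw [ENNReal.ofReal_pow (norm_nonneg _), ofReal_norm]

lemma tsum_enorm_sq_eq [CompleteSpace E] [NormedAddCommGroup F] [InnerProductSpace ℝ F]
    [CompleteSpace F] {ι κ : Type*} (b : HilbertBasis ι ℝ E) (c : HilbertBasis κ ℝ F)
    (T : E →L[ℝ] F) :
    ∑' i, ‖T (b i)‖ₑ ^ 2 = ∑' j, ‖ContinuousLinearMap.adjoint T (c j)‖ₑ ^ 2 := by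
  simp_rw [enorm_sq_eq_tsum c (T _), enorm_sq_eq_tsum b (ContinuousLinearMap.adjoint T _)]
  rw [ENNReal.tsum_comm]
  refine tsum_congr fun j => tsum_congr fun i => ?_
  rw [ContinuousLinearMap.adjoint_inner_right, real_inner_comm]

lemma hsNorm_eq [CompleteSpace E] [NormedAddCommGroup F] [InnerProductSpace ℝ F]
    [CompleteSpace F] {ι : Type*} (b : HilbertBasis ι ℝ E) (T : E →L[ℝ] F) :
    hsNorm T = (∑' i, ‖T (b i)‖ₑ ^ 2) ^ (1 / 2 : ℝ) := by
  obtain ⟨w, c, -⟩ := exists_hilbertBasis ℝ F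
  rw [hsNorm, tsum_enorm_sq_eq _ c, tsum_enorm_sq_eq b c]

/-- Strongly continuous semigroups of bounded operators (only the values at `t ≥ 0` matter). -/
structure IsC0Semigroup (S : ℝ → E →L[ℝ] E) : Prop where
  zero : S 0 = ContinuousLinearMap.id ℝ E
  add : ∀ s t, 0 ≤ s → 0 ≤ t → S (s + t) = (S s).comp (S t)
  continuousOn : ∀ x, ContinuousOn (fun t => S t x) (Ici 0)

/-- `S` is the strongly continuous semigroup generated by (the closure of) `A`: its infinitesimal
generator `x ↦ lim_{t → 0+} (S t x - x) / t` has the closure of the graph of `A` as its graph. -/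
def Generates (A : E →ₗ.[ℝ] E) (S : ℝ → E →L[ℝ] E) : Prop :=
  IsC0Semigroup S ∧ ∀ x y : E, (x, y) ∈ A.graph.topologicalClosure ↔
    Tendsto (fun t : ℝ => t⁻¹ • (S t x - x)) (𝓝[>] 0) (𝓝 y)

end Operators

/-! ### Spectral facts which the spaces below rest on -/

section Spectral

variable {U : Type*} [NormedAddCommGroup U] [InnerProductSpace ℝ U] [CompleteSpace U]
  {L : U →ₗ.[ℝ] U}

lemma IsTraceClass.isCompactOperator {K : U →L[ℝ] U} (hK : IsTraceClass K) :
    IsCompactOperator K := by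
  obtain ⟨a, b, hs, hK⟩ := hK
  let R : ℕ → U →L[ℝ] U := fun n => (innerSL ℝ (a n)).smulRight (b n)
  have hR : ∀ n, ‖R n‖ ≤ ‖a n‖ * ‖b n‖ := fun n => by
    simp [R, ContinuousLinearMap.norm_smulRight_apply]
  have hsum : Summable R := Summable.of_norm_bounded hs hR
  have hKR : K = ∑' n, R n := by
    ext x
    have h1 : HasSum (fun n => (ContinuousLinearMap.apply ℝ U x) (R n))
        ((ContinuousLinearMap.apply ℝ U x) (∑' n, R n)) :=
      hsum.hasSum.mapL (ContinuousLinearMap.apply ℝ U x)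
    have h2 : HasSum (fun n => ⟪a n, x⟫_ℝ • b n) ((∑' n, R n) x) := by
      simpa [R] using h1
    exact (hK x).unique h2
  rw [hKR]
  refine isCompactOperator_of_tendsto hsum.hasSum (Eventually.of_forall fun s => ?_)
  have hc : ∀ n, R n ∈ compactOperator (RingHom.id ℝ) U U := fun n => by
    change IsCompactOperator (R n)
    have h1 : IsCompactOperator (innerSL ℝ (a n)) := by
      exact isCompactOperator_id.comp_clm (innerSL ℝ (a n))
    exact h1.clm_comp (ContinuousLinearMap.toSpanSingleton ℝ (b n))
  exact Submodule.sum_mem (compactOperator (RingHom.id ℝ) U U) fun n _ => hc n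

lemma IsAdmissible.symm (hL : IsAdmissible L) (x y : L.domain) :
    ⟪L x, (y : U)⟫_ℝ = ⟪(x : U), L y⟫_ℝ := by
  have h := LinearPMap.adjoint_isFormalAdjoint (T := L) hL.selfAdjoint.dense_domain
  rw [LinearPMap.isSelfAdjoint_def.1 hL.selfAdjoint] at h
  exact h x y

lemma IsAdmissible.pos (hL : IsAdmissible L) {m : ℝ} {x : U} (hx : x ∈ eigenspace L m)
    (hm : m ≤ 0) : x = 0 := by
  obtain ⟨K, hK, -⟩ := hL.inverse
  obtain ⟨h, hx⟩ := hx
  have h1 := hL.nonneg ⟨x, h⟩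
  rw [hx, real_inner_smul_left] at h1
  by_contra hne
  have h2 : 0 < ⟪x, x⟫_ℝ := real_inner_self_pos.2 hne
  have h3 : m = 0 := le_antisymm hm (by
    by_contra h4
    exact absurd h1 (not_le.2 (mul_neg_of_neg_of_pos (not_le.1 h4) h2)))
  have h5 := hK.1 ⟨x, h⟩
  rw [hx, h3] at h5
  simp only [zero_smul, map_zero] at h5
  exact hne h5.symm

/-- The eigenvectors are complete. -/
lemma IsAdmissible.complete (hL : IsAdmissible L) {x : U}
    (hx : ∀ m, ∀ y ∈ eigenspace L m, ⟪y, x⟫_ℝ = 0) : x = 0 := by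
  obtain ⟨K, hK, hT⟩ := hL.inverse
  have hsymm : (K : U →ₗ[ℝ] U).IsSymmetric := by
    intro y z
    obtain ⟨hy, hy'⟩ := hK.2 y
    obtain ⟨hz, hz'⟩ := hK.2 z
    have := hL.symm ⟨K y, hy⟩ ⟨K z, hz⟩
    rw [hy', hz'] at this
    exact this.symm
  have h := ContinuousLinearMap.orthogonalComplement_iSup_eigenspaces_eq_bot
    hT.isCompactOperator hsymm
  have hmem : x ∈ (⨆ m, Module.End.eigenspace (K : U →ₗ[ℝ] U) m)ᗮ := by
    rw [Submodule.mem_orthogonal]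
    intro y hy
    refine Submodule.iSup_induction _ (motive := fun y => ⟪y, x⟫_ℝ = 0) hy ?_ (by simp) ?_
    · intro k y hy
      rw [Module.End.mem_eigenspace_iff] at hy
      have hy : K y = k • y := hy
      obtain ⟨hd, hLK⟩ := hK.2 y
      by_cases hk : k = 0
      · have h0 : (⟨K y, hd⟩ : L.domain) = 0 := by
          ext
          simp [hy, hk]
        rw [h0, L.map_zero] at hLK
        rw [← hLK, inner_zero_left]
      · have hyd : y ∈ L.domain := by
          have := L.domain.smul_mem k⁻¹ hd
          rwa [hy, smul_smul, inv_mul_cancel₀ hk, one_smul] at this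
        refine hx k⁻¹ y ⟨hyd, ?_⟩
        have h1 : (⟨K y, hd⟩ : L.domain) = k • ⟨y, hyd⟩ := by
          ext
          simp [hy]
        rw [h1, L.map_smul] at hLK
        have h2 := congrArg (fun z => k⁻¹ • z) hLK
        simpa only [smul_smul, inv_mul_cancel₀ hk, one_smul] using h2
    · intro y z hy hz
      rw [inner_add_left, hy, hz, add_zero]
  rw [h] at hmem
  exact (Submodule.mem_bot ℝ).1 hmem

lemma IsAdmissible.closure_eigenspace (hL : IsAdmissible L) (m : ℝ) :
    (eigenspace L m).topologicalClosure = eigenspace L m := by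
  refine IsClosed.submodule_topologicalClosure_eq ?_
  have hc : IsClosed (L.graph : Set (U × U)) := hL.selfAdjoint.isClosed
  have he : (eigenspace L m : Set U) = (fun x : U => (x, m • x)) ⁻¹' (L.graph : Set (U × U)) := by
    ext x
    constructor
    · rintro ⟨h, hx⟩
      exact (LinearPMap.mem_graph_iff L).2 ⟨⟨x, h⟩, rfl, hx⟩
    · intro h
      obtain ⟨y, hy, hy'⟩ := (LinearPMap.mem_graph_iff L).1 h
      obtain rfl : (y : U) = x := hy
      exact ⟨y.2, hy'⟩
  rw [he]
  exact hc.preimage (by fun_prop)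

lemma IsAdmissible.eigenproj_mem (hL : IsAdmissible L) (m : ℝ) (x : U) :
    eigenproj L m x ∈ eigenspace L m := by
  rw [← hL.closure_eigenspace m]
  exact Submodule.starProjection_apply_mem _ _

lemma IsAdmissible.ortho (hL : IsAdmissible L) {m k : ℝ} (hmk : m ≠ k) {x y : U}
    (hx : x ∈ eigenspace L m) (hy : y ∈ eigenspace L k) : ⟪x, y⟫_ℝ = 0 := by
  obtain ⟨hx, hx'⟩ := hx
  obtain ⟨hy, hy'⟩ := hy
  have h := hL.symm ⟨x, hx⟩ ⟨y, hy⟩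
  rw [hx', hy', real_inner_smul_left, real_inner_smul_right] at h
  have h2 : (m - k) * ⟪x, y⟫_ℝ = 0 := by
    rw [sub_mul]
    exact sub_eq_zero.2 h
  exact (mul_eq_zero.1 h2).resolve_left (sub_ne_zero.2 hmk)

lemma eigenproj_inner (m : ℝ) (x y : U) :
    ⟪eigenproj L m x, y⟫_ℝ = ⟪x, eigenproj L m y⟫_ℝ :=
  Submodule.inner_starProjection_left_eq_right _ _ _

lemma eigenproj_of_mem {m : ℝ} {x : U} (hx : x ∈ eigenspace L m) : eigenproj L m x = x :=
  Submodule.starProjection_eq_self_iff.2 (Submodule.le_topologicalClosure _ hx)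

lemma IsAdmissible.eigenproj_eigenproj (hL : IsAdmissible L) {m k : ℝ} (hmk : m ≠ k) (x : U) :
    eigenproj L k (eigenproj L m x) = 0 := by
  rw [← inner_self_eq_zero (𝕜 := ℝ), eigenproj_inner]
  refine hL.ortho hmk (hL.eigenproj_mem m x) ?_
  rw [eigenproj_of_mem (hL.eigenproj_mem k _)]
  exact hL.eigenproj_mem k _

lemma IsAdmissible.eq_of_eigenproj (hL : IsAdmissible L) {x y : U}
    (h : ∀ m, eigenproj L m x = eigenproj L m y) : x = y := by
  refine sub_eq_zero.1 (hL.complete fun m z hz => ?_)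
  rw [← eigenproj_of_mem hz, eigenproj_inner, map_sub, h m, sub_self, inner_zero_right]

/-- The projections of a convergent eigenfunction expansion. -/
lemma IsAdmissible.eigenproj_tsum (hL : IsAdmissible L) {c : ℝ → ℝ} {x : U}
    (h : Summable fun m => c m • eigenproj L m x) (k : ℝ) :
    eigenproj L k (∑' m, c m • eigenproj L m x) = c k • eigenproj L k x := by
  rw [ContinuousLinearMap.map_tsum _ h, tsum_eq_single k]
  · rw [map_smul, eigenproj_of_mem (hL.eigenproj_mem k x)]
  · intro m hm
    rw [map_smul, hL.eigenproj_eigenproj hm, smul_zero]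

lemma IsAdmissible.orthogonalFamily (hL : IsAdmissible L) :
    OrthogonalFamily ℝ (fun m : ℝ => eigenspace L m) fun m => (eigenspace L m).subtypeₗᵢ := by
  intro m k hmk x y
  exact hL.ortho hmk x.2 y.2

lemma IsAdmissible.summable_of_bound (hL : IsAdmissible L) {c : ℝ → ℝ} {C : ℝ} {x : U}
    (h : ∀ m, ‖c m • eigenproj L m x‖ ≤ C * ‖eigenproj L m x‖) :
    Summable fun m => c m • eigenproj L m x := by
  have h1 : Summable fun m => ‖eigenproj L m x‖ ^ 2 := by
    refine summable_of_sum_le (c := ‖x‖ ^ 2) (fun _ => sq_nonneg _) fun s => ?_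
    have e1 := hL.orthogonalFamily.norm_sum (fun m => ⟨eigenproj L m x, hL.eigenproj_mem m x⟩) s
    change ‖∑ m ∈ s, eigenproj L m x‖ ^ 2 = ∑ m ∈ s, ‖eigenproj L m x‖ ^ 2 at e1
    have e2 : ∑ m ∈ s, ‖eigenproj L m x‖ ^ 2 = ⟪∑ m ∈ s, eigenproj L m x, x⟫_ℝ := by
      rw [sum_inner]
      refine Finset.sum_congr rfl fun m _ => ?_
      rw [← real_inner_self_eq_norm_sq, ← eigenproj_inner,
        eigenproj_of_mem (hL.eigenproj_mem m x)]
    have e3 := real_inner_le_norm (∑ m ∈ s, eigenproj L m x) x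
    rw [← e2, ← e1] at e3
    rw [← e1]
    nlinarith [norm_nonneg (∑ m ∈ s, eigenproj L m x), norm_nonneg x]
  have h2 := (hL.orthogonalFamily.summable_iff_norm_sq_summable
    (fun m => ⟨c m • eigenproj L m x, (eigenspace L m).smul_mem _ (hL.eigenproj_mem m x)⟩)).2
  refine h2 ?_
  refine Summable.of_nonneg_of_le (fun _ => sq_nonneg _) (fun m => ?_) (h1.mul_left (C ^ 2))
  rw [← mul_pow]
  exact pow_le_pow_left₀ (norm_nonneg _) (h m) 2

lemma IsAdmissible.negHalf_domain (hL : IsAdmissible L) (x : U) :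
    x ∈ (fracPow L (-1 / 2)).domain := by
  obtain ⟨K, hK, -⟩ := hL.inverse
  refine hL.summable_of_bound (c := fun m => m ^ (-1 / 2 : ℝ)) (C := ‖K‖ ^ (1 / 2 : ℝ)) fun m => ?_
  rw [norm_smul]
  by_cases h0 : eigenproj L m x = 0
  · simp [h0]
  refine mul_le_mul_of_nonneg_right ?_ (norm_nonneg _)
  have hm : 0 < m := by
    by_contra hm
    exact h0 (hL.pos (hL.eigenproj_mem m x) (not_lt.1 hm))
  obtain ⟨hd, he⟩ := hL.eigenproj_mem m x
  have h1 := hK.1 ⟨_, hd⟩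
  rw [he, map_smul] at h1
  have h2 : ‖eigenproj L m x‖ ≤ m * ‖K‖ * ‖eigenproj L m x‖ := by
    calc ‖eigenproj L m x‖ = ‖m • K (eigenproj L m x)‖ := by rw [h1]
      _ = m * ‖K (eigenproj L m x)‖ := by rw [norm_smul, Real.norm_of_nonneg hm.le]
      _ ≤ m * (‖K‖ * ‖eigenproj L m x‖) := by
        gcongr
        exact K.le_opNorm _
      _ = _ := by ring
  have h3 : 1 ≤ m * ‖K‖ := by
    have := norm_pos_iff.2 h0
    by_contra h4
    nlinarith
  have h4 : m⁻¹ ≤ ‖K‖ := by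
    rw [inv_le_iff_one_le_mul₀ hm]
    linarith
  rw [Real.norm_of_nonneg (Real.rpow_nonneg hm.le _),
    show (-1 / 2 : ℝ) = -(1 / 2) by norm_num, Real.rpow_neg hm.le, ← Real.inv_rpow hm.le]
  exact Real.rpow_le_rpow (inv_nonneg.2 hm.le) h4 (by norm_num)

/-- `L ^ (-1/2)`, which is defined everywhere. -/
def IsAdmissible.negHalf (hL : IsAdmissible L) : U →ₗ[ℝ] U :=
  (fracPow L (-1 / 2)).toFun ∘ₗ LinearMap.codRestrict _ LinearMap.id hL.negHalf_domain

lemma IsAdmissible.eigenproj_negHalf (hL : IsAdmissible L) (x : U) (m : ℝ) :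
    eigenproj L m (hL.negHalf x) = m ^ (-1 / 2 : ℝ) • eigenproj L m x :=
  hL.eigenproj_tsum (hL.negHalf_domain x) m

lemma IsAdmissible.negHalf_symm (hL : IsAdmissible L) : hL.negHalf.IsSymmetric := by
  intro x y
  have hx : HasSum (fun m => m ^ (-1 / 2 : ℝ) • eigenproj L m x) (hL.negHalf x) :=
    Summable.hasSum (hL.negHalf_domain x)
  have hy : HasSum (fun m => m ^ (-1 / 2 : ℝ) • eigenproj L m y) (hL.negHalf y) :=
    Summable.hasSum (hL.negHalf_domain y)
  have h1 := hx.mapL ((innerSL ℝ) y)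
  have h2 := hy.mapL ((innerSL ℝ) x)
  rw [real_inner_comm]
  refine h1.unique (h2.congr_fun ?_)
  intro m
  simp only [innerSL_apply_apply, real_inner_smul_right]
  rw [← eigenproj_inner, real_inner_comm]

lemma IsAdmissible.half_negHalf (hL : IsAdmissible L) (y : U) :
    ∃ h : hL.negHalf y ∈ (fracPow L (1 / 2)).domain, fracPow L (1 / 2) ⟨hL.negHalf y, h⟩ = y := by
  have h1 : ∀ m, m ^ (1 / 2 : ℝ) • eigenproj L m (hL.negHalf y) = (1 : ℝ) • eigenproj L m y := by
    intro m
    rw [hL.eigenproj_negHalf, smul_smul, one_smul]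
    rcases le_or_gt m 0 with hm | hm
    · rw [hL.pos (hL.eigenproj_mem m y) hm, smul_zero]
    · rw [← Real.rpow_add hm]
      norm_num
  have hs : Summable fun m : ℝ => (1 : ℝ) • eigenproj L m y :=
    hL.summable_of_bound (c := fun _ => 1) (C := 1) (by simp)
  refine ⟨hs.congr fun m => (h1 m).symm, ?_⟩
  change ∑' m : ℝ, m ^ (1 / 2 : ℝ) • eigenproj L m (hL.negHalf y) = y
  rw [tsum_congr h1]
  refine hL.eq_of_eigenproj fun k => ?_
  rw [hL.eigenproj_tsum (c := fun _ => 1) hs, one_smul]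

lemma IsAdmissible.negHalf_half (hL : IsAdmissible L) (x : (fracPow L (1 / 2)).domain) :
    hL.negHalf (fracPow L (1 / 2) x) = x := by
  refine hL.eq_of_eigenproj fun k => ?_
  rw [hL.eigenproj_negHalf]
  have : eigenproj L k (fracPow L (1 / 2) x) = k ^ (1 / 2 : ℝ) • eigenproj L k (x : U) :=
    hL.eigenproj_tsum x.2 k
  rw [this, smul_smul]
  rcases le_or_gt k 0 with hm | hm
  · rw [hL.pos (hL.eigenproj_mem k _) hm, smul_zero]
  · rw [← Real.rpow_add hm]
    norm_num

end Spectral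

/-! ### The spaces `V = D(Λ ^ (1/2))`, `V'` and `H = U × V'` -/

section Spaces

variable {U : Type*} [NormedAddCommGroup U] [InnerProductSpace ℝ U] [CompleteSpace U]
  {L : U →ₗ.[ℝ] U}

/-- `V = D(Λ ^ (1/2))`, with the inner product `⟪Λ ^ (1/2) x, Λ ^ (1/2) y⟫`. -/
def V (_ : IsAdmissible L) : Type _ := (fracPow L (1 / 2)).domain

instance (hL : IsAdmissible L) : AddCommGroup (V hL) :=
  inferInstanceAs (AddCommGroup (fracPow L (1 / 2)).domain)

instance (hL : IsAdmissible L) : Module ℝ (V hL) :=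
  inferInstanceAs (Module ℝ (fracPow L (1 / 2)).domain)

/-- The inclusion of `V` into `U`, as a linear map. -/
def V.val (hL : IsAdmissible L) : V hL →ₗ[ℝ] U := (fracPow L (1 / 2)).domain.subtype

/-- `Λ ^ (1/2)` on `V`. -/
def V.half (hL : IsAdmissible L) : V hL →ₗ[ℝ] U := (fracPow L (1 / 2)).toFun

lemma V.half_injective (hL : IsAdmissible L) : Function.Injective (V.half hL) := by
  intro x y h
  have h' := congrArg hL.negHalf h
  exact Subtype.ext ((hL.negHalf_half x).symm.trans (h'.trans (hL.negHalf_half y)))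

/-- The inner product of `V`. -/
@[reducible]
def V.core (hL : IsAdmissible L) : InnerProductSpace.Core ℝ (V hL) where
  inner x y := ⟪V.half hL x, V.half hL y⟫_ℝ
  conj_inner_symm x y := real_inner_comm _ _
  re_inner_nonneg x := real_inner_self_nonneg
  add_left x y z := by rw [map_add, inner_add_left]
  smul_left x y r := by
    rw [map_smul, real_inner_smul_left]
    rfl
  definite x h := V.half_injective hL (by
    rw [map_zero]
    exact inner_self_eq_zero.1 h)

instance (hL : IsAdmissible L) : NormedAddCommGroup (V hL) := (V.core hL).toNormedAddCommGroup

instance (hL : IsAdmissible L) : InnerProductSpace ℝ (V hL) :=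
  InnerProductSpace.ofCore (V.core hL).toCore

lemma V.inner_def (hL : IsAdmissible L) (x y : V hL) :
    ⟪x, y⟫_ℝ = ⟪V.half hL x, V.half hL y⟫_ℝ := rfl

lemma V.norm_half (hL : IsAdmissible L) (x : V hL) : ‖V.half hL x‖ = ‖x‖ := by
  rw [@norm_eq_sqrt_real_inner U, @norm_eq_sqrt_real_inner (V hL), V.inner_def]

/-- `Λ ^ (1/2)` maps `V` isometrically onto `U`. -/
def V.iso (hL : IsAdmissible L) : V hL ≃ₗᵢ[ℝ] U where
  toLinearEquiv := LinearEquiv.ofBijective (V.half hL) ⟨V.half_injective hL, fun y => by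
    obtain ⟨h, hy⟩ := hL.half_negHalf y
    exact ⟨⟨_, h⟩, hy⟩⟩
  norm_map' := V.norm_half hL

instance (hL : IsAdmissible L) : CompleteSpace (V hL) :=
  (completeSpace_congr (e := (V.iso hL).toEquiv) (V.iso hL).isometry.isUniformEmbedding).2
    inferInstance

/-- The continuous inclusion of `V` into `U`. -/
def V.incl (hL : IsAdmissible L) : V hL →L[ℝ] U where
  toLinearMap := V.val hL
  cont := by
    have h : ⇑(V.val hL) = hL.negHalf ∘ V.iso hL := funext fun x => (hL.negHalf_half x).symm
    change Continuous ⇑(V.val hL)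
    rw [h]
    exact hL.negHalf_symm.continuous.comp (V.iso hL).continuous

/-- The dual space `V'` of `V`, with the dual norm. -/
def DualV (hL : IsAdmissible L) : Type _ := StrongDual ℝ (V hL)

instance (hL : IsAdmissible L) : NormedAddCommGroup (DualV hL) :=
  inferInstanceAs (NormedAddCommGroup (StrongDual ℝ (V hL)))

/-- `V'` is a Hilbert space: its norm comes from the inner product that
the Riesz isomorphism transports from `V`. -/
instance (hL : IsAdmissible L) : InnerProductSpace ℝ (DualV hL) where
  toNormedSpace := inferInstanceAs (NormedSpace ℝ (StrongDual ℝ (V hL)))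
  inner f g := ⟪(InnerProductSpace.toDual ℝ (V hL)).symm f,
    (InnerProductSpace.toDual ℝ (V hL)).symm g⟫_ℝ
  norm_sq_eq_re_inner f :=
    (congrArg (· ^ 2)
      (LinearIsometryEquiv.norm_map (InnerProductSpace.toDual ℝ (V hL)).symm f).symm).trans
      (norm_sq_eq_re_inner (𝕜 := ℝ) ((InnerProductSpace.toDual ℝ (V hL)).symm f))
  conj_inner_symm f g := real_inner_comm _ _
  add_left f g h := by
    refine Eq.trans ?_ (inner_add_left (𝕜 := ℝ) _ _ _)
    exact congrArg (fun z => ⟪z, (InnerProductSpace.toDual ℝ (V hL)).symm h⟫_ℝ)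
      (map_add (InnerProductSpace.toDual ℝ (V hL)).symm f g)
  smul_left f g r := by
    refine Eq.trans ?_ (inner_smul_left (𝕜 := ℝ) _ _ _)
    exact congrArg (fun z => ⟪z, (InnerProductSpace.toDual ℝ (V hL)).symm g⟫_ℝ)
      (LinearIsometryEquiv.map_smulₛₗ (InnerProductSpace.toDual ℝ (V hL)).symm r f)

instance (hL : IsAdmissible L) : CompleteSpace (DualV hL) :=
  inferInstanceAs (CompleteSpace (StrongDual ℝ (V hL)))

/-- The identification of `V'` with Mathlib's dual space. -/
def DualV.equiv (hL : IsAdmissible L) : DualV hL ≃ₗᵢ[ℝ] StrongDual ℝ (V hL) where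
  toFun f := f
  invFun f := f
  map_add' _ _ := rfl
  map_smul' _ _ := rfl
  left_inv _ := rfl
  right_inv _ := rfl
  norm_map' _ := rfl

/-- The embedding of `U` into `V'`: `u` acts on `V` as `v ↦ ⟪u, v⟫_U`. -/
def emb (hL : IsAdmissible L) : U →L[ℝ] DualV hL :=
  LinearMap.mkContinuous
    ((DualV.equiv hL).symm.toLinearEquiv.toLinearMap ∘ₗ
      { toFun := fun u => (innerSL ℝ u).comp (V.incl hL)
        map_add' := fun u v => by rw [map_add, ContinuousLinearMap.add_comp]
        map_smul' := fun r u => by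
          ext v
          simp })
    ‖V.incl hL‖ fun u => by
      change ‖(innerSL ℝ u).comp (V.incl hL)‖ ≤ _
      refine (ContinuousLinearMap.opNorm_comp_le _ _).trans ?_
      rw [innerSL_apply_norm, mul_comm]

lemma emb_apply (hL : IsAdmissible L) (u : U) (v : V hL) :
    DualV.equiv hL (emb hL u) v = ⟪u, V.incl hL v⟫_ℝ := rfl

lemma emb_injective (hL : IsAdmissible L) : Function.Injective (emb hL) := by
  rw [injective_iff_map_eq_zero]
  intro u hu
  have h1 : hL.negHalf u = 0 := by
    refine ext_inner_right ℝ fun y => ?_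
    obtain ⟨h, -⟩ := hL.half_negHalf y
    have h2 := emb_apply hL u ⟨hL.negHalf y, h⟩
    rw [hu, LinearIsometryEquiv.map_zero] at h2
    rw [hL.negHalf_symm u y, inner_zero_left]
    exact h2.symm
  refine hL.eq_of_eigenproj fun m => ?_
  have h3 := hL.eigenproj_negHalf u m
  rw [h1, map_zero] at h3
  rw [map_zero]
  rcases le_or_gt m 0 with hm | hm
  · exact hL.pos (hL.eigenproj_mem m u) hm
  · exact (smul_eq_zero.1 h3.symm).resolve_left (Real.rpow_pos_of_pos hm _).ne'

/-- `Λ` as a map from `V` to `V'`: `(Λ v) w = ⟪Λ ^ (1/2) v, Λ ^ (1/2) w⟫_U = ⟪v, w⟫_V`. -/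
def lapl (hL : IsAdmissible L) : V hL →ₗ[ℝ] DualV hL :=
  (DualV.equiv hL).symm.toLinearEquiv.toLinearMap ∘ₗ
    { toFun := fun v => innerSL ℝ v
      map_add' := fun v w => map_add _ v w
      map_smul' := fun r v => by
        ext w
        simp }

lemma lapl_apply (hL : IsAdmissible L) (v w : V hL) :
    DualV.equiv hL (lapl hL v) w = ⟪v, w⟫_ℝ := rfl

/-- The inclusion of `V` into `V'`. -/
def embV (hL : IsAdmissible L) : V hL →ₗ[ℝ] DualV hL := (emb hL).toLinearMap ∘ₗ V.val hL

lemma embV_injective (hL : IsAdmissible L) : Function.Injective (embV hL) :=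
  (emb_injective hL).comp Subtype.val_injective

/-- The extension of `Λ` to an unbounded operator in `V'` with domain `V`. -/
def extOp (hL : IsAdmissible L) : DualV hL →ₗ.[ℝ] DualV hL where
  domain := LinearMap.range (embV hL)
  toFun := lapl hL ∘ₗ (LinearEquiv.ofInjective (embV hL) (embV_injective hL)).symm.toLinearMap

/-- `H = U × V'`, with the norm `‖(x₁, x₂)‖ ^ 2 = ‖x₁‖_U ^ 2 + ‖x₂‖_{V'} ^ 2`. -/
def H (hL : IsAdmissible L) : Type _ := WithLp 2 (U × DualV hL)

instance (hL : IsAdmissible L) : NormedAddCommGroup (H hL) :=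
  inferInstanceAs (NormedAddCommGroup (WithLp 2 (U × DualV hL)))

instance (hL : IsAdmissible L) : InnerProductSpace ℝ (H hL) :=
  inferInstanceAs (InnerProductSpace ℝ (WithLp 2 (U × DualV hL)))

instance (hL : IsAdmissible L) : CompleteSpace (H hL) :=
  inferInstanceAs (CompleteSpace (WithLp 2 (U × DualV hL)))

/-- The linear identification of `H` with the product `U × V'`. -/
def H.equiv (hL : IsAdmissible L) : H hL ≃L[ℝ] U × DualV hL where
  toLinearEquiv := WithLp.linearEquiv 2 ℝ (U × DualV hL)
  continuous_toFun := WithLp.prod_continuous_ofLp 2 U (DualV hL)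
  continuous_invFun := WithLp.prod_continuous_toLp 2 U (DualV hL)

lemma H.norm_sq (hL : IsAdmissible L) (x : H hL) :
    ‖x‖ ^ 2 = ‖(H.equiv hL x).1‖ ^ 2 + ‖(H.equiv hL x).2‖ ^ 2 :=
  WithLp.prod_norm_sq_eq_of_L2 (α := U) (β := DualV hL) x

/-- The component of an element of `H` in `U`. -/
def H.fst (hL : IsAdmissible L) : H hL →ₗ[ℝ] U :=
  LinearMap.fst ℝ U (DualV hL) ∘ₗ (H.equiv hL).toLinearEquiv.toLinearMap

/-- The component of an element of `H` in `V'`. -/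
def H.snd (hL : IsAdmissible L) : H hL →ₗ[ℝ] DualV hL :=
  LinearMap.snd ℝ U (DualV hL) ∘ₗ (H.equiv hL).toLinearEquiv.toLinearMap

/-- `G u = (0, u)`. -/
def G (hL : IsAdmissible L) : U →L[ℝ] H hL :=
  (H.equiv hL).symm.toContinuousLinearMap.comp
    ((ContinuousLinearMap.inr ℝ U (DualV hL)).comp (emb hL))

/-- The domain of the operator matrix: all `(x₁, x₂)` with `x₁ ∈ V`, `x₂ ∈ U` and
`x₂ ∈ D(Λ ^ α)`, where `Λ ^ α` is the power of the extension of `Λ` to `V'`. -/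
def waveDomain (hL : IsAdmissible L) (α : ℝ) : Submodule ℝ (H hL) :=
  (fracPow L (1 / 2)).domain.comap (H.fst hL) ⊓
    ((LinearMap.range (emb hL).toLinearMap).comap (H.snd hL) ⊓
      (fracPow (extOp hL) α).domain.comap (H.snd hL))

/-- The first component of an element of the domain, in `V`. -/
def domFst (hL : IsAdmissible L) (α : ℝ) : waveDomain hL α →ₗ[ℝ] V hL :=
  LinearMap.codRestrict (fracPow L (1 / 2)).domain (H.fst hL ∘ₗ (waveDomain hL α).subtype)
    fun x => x.2.1

/-- The second component of an element of the domain, in `U`. -/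
def domSnd (hL : IsAdmissible L) (α : ℝ) : waveDomain hL α →ₗ[ℝ] U :=
  (LinearEquiv.ofInjective (emb hL).toLinearMap (emb_injective hL)).symm.toLinearMap ∘ₗ
    LinearMap.codRestrict (LinearMap.range (emb hL).toLinearMap)
      (H.snd hL ∘ₗ (waveDomain hL α).subtype) fun x => x.2.2.1

/-- `Λ ^ α x₂` for an element `(x₁, x₂)` of the domain. -/
def domPow (hL : IsAdmissible L) (α : ℝ) : waveDomain hL α →ₗ[ℝ] DualV hL :=
  (fracPow (extOp hL) α).toFun ∘ₗ
    LinearMap.codRestrict (fracPow (extOp hL) α).domain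
      (H.snd hL ∘ₗ (waveDomain hL α).subtype) fun x => x.2.2.2

/-- The damped wave operator `𝒜 (x₁, x₂) = (x₂, - Λ x₁ - ρ Λ ^ α x₂)` in `H = U × V'`. -/
def waveOp (hL : IsAdmissible L) (α ρ : ℝ) : H hL →ₗ.[ℝ] H hL where
  domain := waveDomain hL α
  toFun := (H.equiv hL).symm.toLinearEquiv.toLinearMap ∘ₗ
    (domSnd hL α).prod (-(lapl hL ∘ₗ domFst hL α) - ρ • domPow hL α)

end Spaces

/-! ### Cylindrical Wiener processes and stochastic integrals of deterministic integrands -/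

section Stochastic

variable {U E Ω : Type*} [NormedAddCommGroup U] [InnerProductSpace ℝ U] [CompleteSpace U]
  [NormedAddCommGroup E] [NormedSpace ℝ E] [MeasurableSpace Ω]

/-- `W` is a cylindrical Wiener process on `U`, `W t u` being the real random variable `⟪W_t, u⟫`:
a centred Gaussian family with covariance `E[⟪W_s, u⟫ ⟪W_t, v⟫] = min s t ⟪u, v⟫` for which
every `⟪W, u⟫` has almost surely continuous paths. -/
structure IsCylindricalWiener (W : ℝ≥0 → U → Ω → ℝ) (P : Measure Ω) : Prop where
  gaussian : IsGaussianProcess (fun p : ℝ≥0 × U => W p.1 p.2) P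
  mean : ∀ t u, ∫ ω, W t u ω ∂P = 0
  covariance : ∀ s t u v, ∫ ω, W s u ω * W t v ω ∂P = min (s : ℝ) t * ⟪u, v⟫_ℝ
  continuous : ∀ u, ∀ᵐ ω ∂P, Continuous fun t => W t u ω

/-- Deterministic elementary integrands on `(0, t]`:
`s ↦ ∑ i, 1_{(a i, b i]}(s) ⟪u i, ·⟫ y i`, a step function whose values are
operators of finite rank from `U` to `E`. -/
structure Elementary (U E : Type*) (t : ℝ≥0) where
  n : ℕ
  a : Fin n → ℝ≥0
  b : Fin n → ℝ≥0
  u : Fin n → U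
  y : Fin n → E
  a_le_b : ∀ i, a i ≤ b i
  b_le : ∀ i, b i ≤ t

/-- The operator-valued step function of an elementary integrand. -/
def Elementary.toFun {t : ℝ≥0} (f : Elementary U E t) (s : ℝ) : U →L[ℝ] E :=
  ∑ i, (Ioc (f.a i : ℝ) (f.b i)).indicator (fun _ => (innerSL ℝ (f.u i)).smulRight (f.y i)) s

/-- The integral `∑ i, (⟪W_{b i}, u i⟫ - ⟪W_{a i}, u i⟫) y i` of an elementary integrand. -/
def Elementary.integral {t : ℝ≥0} (f : Elementary U E t) (W : ℝ≥0 → U → Ω → ℝ) (ω : Ω) : E :=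
  ∑ i, (W (f.b i) (f.u i) ω - W (f.a i) (f.u i) ω) • f.y i

/-- `X` is the stochastic integral `∫_0^t Φ s dW_s`: it is the limit in `L²(Ω; E)` of the
integrals of elementary integrands that approximate `Φ` in `L²((0, t]; L₂(U, E))`. -/
def IsStochasticIntegral (W : ℝ≥0 → U → Ω → ℝ) (P : Measure Ω) (t : ℝ≥0) (Φ : ℝ → U →L[ℝ] E)
    (X : Ω → E) : Prop :=
  MemLp X 2 P ∧ ∃ f : ℕ → Elementary U E t,
    Tendsto (fun n => ∫⁻ s in Ioc (0 : ℝ) t, hsNorm ((f n).toFun s - Φ s) ^ 2) atTop (𝓝 0) ∧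
    Tendsto (fun n => eLpNorm (fun ω => (f n).integral W ω - X ω) 2 P) atTop (𝓝 0)

end Stochastic

end DampedWave

end

/-!
The energy identity `⟪x, A x⟫ = -ρ ⟪Λ ^ α x₂, x₂⟫ ≤ 0` in `V'` makes `A` dissipative, so every
semigroup it generates is contractive. Along an eigenbasis `(e i)` of `Λ` with eigenvalues `μ i`,
the space `H` splits into the planes spanned by `(e i, 0)` and `(0, √(μ i) e i)`, which are
invariant under `A`; identifying such a plane with `ℂ`, `A` acts on it as a damped oscillator, and
the sum of the matrix exponentials is the semigroup. This sum converges strongly because each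
exponential is a contraction, however large `μ i` is.

Since `‖G (e i)‖ ^ 2 = ‖e i‖_{V'} ^ 2 = (μ i)⁻¹`, the operator `G` is Hilbert-Schmidt with
`‖G‖ ^ 2 = tr Λ⁻¹`, and contractivity bounds all the Hilbert-Schmidt norms `‖S t ∘ G‖` by `‖G‖`.
For the stochastic convolution, cutting off the modes outside a finite set and freezing time on a
fine partition approximates `s ↦ S (t - s) ∘ G` by elementary integrands; by the Itô isometry their
integrals form a Cauchy sequence in `L²(Ω; H)`, whose limit does not depend on the approximation.
-/

noncomputable section

namespace DampedWave

/-! ### Dissipative operators and contraction semigroups -/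

section Dissipative

variable {E : Type*} [NormedAddCommGroup E] [InnerProductSpace ℝ E]

/-- A (possibly unbounded) operator `A` is dissipative if `⟪x, A x⟫ ≤ 0` on its domain, so that
the norm decreases along the solutions of `u' = A u`. -/
def IsDissipative (A : E →ₗ.[ℝ] E) : Prop := ∀ x : A.domain, ⟪(x : E), A x⟫_ℝ ≤ 0

lemma norm_le_of_inner_deriv_right_nonpos {u u' : ℝ → E} (hu : ContinuousOn u (Ici 0))
    (hu' : ∀ t, 0 ≤ t → HasDerivWithinAt u (u' t) (Ici t) t)
    (h : ∀ t, 0 ≤ t → ⟪u t, u' t⟫_ℝ ≤ 0) {t : ℝ} (ht : 0 ≤ t) : ‖u t‖ ≤ ‖u 0‖ := by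
  refine (sq_le_sq₀ (norm_nonneg _) (norm_nonneg _)).1 ?_
  exact image_le_of_deriv_right_le_deriv_boundary (f := fun s => ‖u s‖ ^ 2) (B' := 0)
    ((hu.mono Icc_subset_Ici_self).norm.pow 2) (fun s hs => (hu' s hs.1).norm_sq) le_rfl
    continuousOn_const (fun _ _ => hasDerivWithinAt_const ..)
    (fun s hs => mul_nonpos_of_nonneg_of_nonpos zero_le_two (h s hs.1)) (right_mem_Icc.2 ht)

lemma IsDissipative.inner_nonpos_of_mem_closure {A : E →ₗ.[ℝ] E} (hA : IsDissipative A)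
    {x y : E} (hxy : (x, y) ∈ A.graph.topologicalClosure) : ⟪x, y⟫_ℝ ≤ 0 := by
  refine closure_minimal (t := {p : E × E | ⟪p.1, p.2⟫_ℝ ≤ 0}) ?_
    (isClosed_le (by fun_prop) continuous_const) hxy
  rintro ⟨a, b⟩ hab
  obtain ⟨c, rfl, rfl⟩ := (LinearPMap.mem_graph_iff A).1 hab
  exact hA c

lemma Generates.mem_closure_graph {A : E →ₗ.[ℝ] E} {S : ℝ → E →L[ℝ] E} (hS : Generates A S)
    {x y : E} (hxy : (x, y) ∈ A.graph.topologicalClosure) {t : ℝ} (ht : 0 ≤ t) :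
    (S t x, S t y) ∈ A.graph.topologicalClosure := by
  refine (hS.2 _ _).2 (((S t).continuous.tendsto y).comp ((hS.2 x y).1 hxy) |>.congr' ?_)
  filter_upwards [self_mem_nhdsWithin] with r (hr : 0 < r)
  have hcomm : S t (S r x) = S r (S t x) := by
    rw [← ContinuousLinearMap.comp_apply, ← ContinuousLinearMap.comp_apply,
      ← hS.1.add t r ht hr.le, ← hS.1.add r t hr.le ht, add_comm]
  rw [Function.comp_apply, map_smul, map_sub, hcomm]

lemma Generates.hasDerivWithinAt {A : E →ₗ.[ℝ] E} {S : ℝ → E →L[ℝ] E} (hS : Generates A S)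
    {x y : E} (hxy : (x, y) ∈ A.graph.topologicalClosure) {t : ℝ} (ht : 0 ≤ t) :
    HasDerivWithinAt (fun s => S s x) (S t y) (Ici t) t := by
  rw [← hasDerivWithinAt_Ioi_iff_Ici, hasDerivWithinAt_iff_tendsto_slope' (by simp)]
  have hshift : Tendsto (fun s : ℝ => s - t) (𝓝[>] t) (𝓝[>] 0) :=
    tendsto_nhdsWithin_iff.2 ⟨tendsto_nhdsWithin_of_tendsto_nhds
      (by simpa using (continuous_sub_right t).tendsto t),
      eventually_mem_nhdsWithin.mono fun _ hs => mem_Ioi.2 (sub_pos.2 hs)⟩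
  refine ((((S t).continuous.tendsto y).comp ((hS.2 x y).1 hxy)).comp hshift).congr' ?_
  filter_upwards [self_mem_nhdsWithin] with s (hs : t < s)
  have hadd : S s x = S t (S (s - t) x) := by
    rw [← ContinuousLinearMap.comp_apply, ← hS.1.add t _ ht (sub_pos.2 hs).le, add_sub_cancel]
  rw [Function.comp_apply, Function.comp_apply, slope_def_module, map_smul, map_sub, hadd]

theorem Generates.norm_apply_le {A : E →ₗ.[ℝ] E} {S : ℝ → E →L[ℝ] E} (hS : Generates A S)
    (hA : IsDissipative A) (hdense : Dense (A.domain : Set E)) {t : ℝ} (ht : 0 ≤ t) (x : E) :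
    ‖S t x‖ ≤ ‖x‖ := by
  refine isClosed_property hdense.denseRange_val
    (isClosed_le (S t).continuous.norm continuous_norm) (fun x : A.domain => ?_) x
  have hx : ((x : E), A x) ∈ A.graph.topologicalClosure :=
    Submodule.le_topologicalClosure _ (A.mem_graph x)
  have h := norm_le_of_inner_deriv_right_nonpos (hS.1.continuousOn x)
    (fun _ hs => hS.hasDerivWithinAt hx hs)
    (fun _ hs => hA.inner_nonpos_of_mem_closure (hS.mem_closure_graph hx hs)) ht
  simpa [hS.1.zero] using h

end Dissipative

section Exponential

variable {F : Type*} [NormedAddCommGroup F] [InnerProductSpace ℝ F] [CompleteSpace F]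

lemma hasDerivAt_exp_smul_apply (B : F →L[ℝ] F) (z : F) (t : ℝ) :
    HasDerivAt (fun s : ℝ => NormedSpace.exp (s • B) z) (NormedSpace.exp (t • B) (B z)) t := by
  simpa using (hasDerivAt_exp_smul_const B t).clm_apply (hasDerivAt_const t z)

lemma hasDerivAt_exp_smul_apply' (B : F →L[ℝ] F) (z : F) (t : ℝ) :
    HasDerivAt (fun s : ℝ => NormedSpace.exp (s • B) z) (B (NormedSpace.exp (t • B) z)) t := by
  simpa using (hasDerivAt_exp_smul_const' B t).clm_apply (hasDerivAt_const t z)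

lemma exp_add_smul (B : F →L[ℝ] F) (s t : ℝ) :
    NormedSpace.exp ((s + t) • B) = NormedSpace.exp (s • B) * NormedSpace.exp (t • B) := by
  let : NormedAlgebra ℚ (F →L[ℝ] F) := NormedAlgebra.restrictScalars ℚ ℝ _
  rw [add_smul]
  exact NormedSpace.exp_add_of_commute (((Commute.refl B).smul_left s).smul_right t)

lemma norm_exp_smul_apply_le {B : F →L[ℝ] F} (hB : ∀ z, ⟪z, B z⟫_ℝ ≤ 0) {t : ℝ} (ht : 0 ≤ t)
    (z : F) : ‖NormedSpace.exp (t • B) z‖ ≤ ‖z‖ := by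
  simpa using norm_le_of_inner_deriv_right_nonpos
    (fun s _ => (hasDerivAt_exp_smul_apply' B z s).continuousAt.continuousWithinAt)
    (fun s _ => (hasDerivAt_exp_smul_apply' B z s).hasDerivWithinAt) (fun _ _ => hB _) ht

lemma norm_exp_smul_apply_sub_le {B : F →L[ℝ] F} (hB : ∀ z, ⟪z, B z⟫_ℝ ≤ 0) {t : ℝ}
    (ht : 0 ≤ t) (z : F) : ‖NormedSpace.exp (t • B) z - z‖ ≤ ‖B z‖ * t := by
  simpa using norm_image_sub_le_of_norm_deriv_le_segment' (a := 0) (b := t) (C := ‖B z‖)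
    (fun s _ => (hasDerivAt_exp_smul_apply B z s).hasDerivWithinAt)
    (fun s hs => norm_exp_smul_apply_le hB hs.1 _) t (right_mem_Icc.2 ht)

lemma tendsto_exp_smul_slope (B : F →L[ℝ] F) (z : F) :
    Tendsto (fun t : ℝ => t⁻¹ • (NormedSpace.exp (t • B) z - z)) (𝓝[>] 0) (𝓝 (B z)) := by
  have h := (hasDerivAt_exp_smul_apply B z 0).hasDerivWithinAt (s := Ioi 0)
  rw [hasDerivWithinAt_iff_tendsto_slope' (by simp)] at h
  simpa [slope_fun_def] using h

end Exponential

/-! ### Block diagonal operators on Hilbert sums -/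

section BlockDiagonal

variable {ι : Type*} {F : ι → Type*} [∀ i, NormedAddCommGroup (F i)]

lemma tendsto_lp_of_dominated {p : ℝ≥0∞} [Fact (1 ≤ p)] (hp : p ≠ ∞) {α : Type*}
    {l : Filter α} {f : α → lp F p} {x : lp F p} {g : ι → ℝ} (hg : Memℓp g p)
    (hfg : ∀ᶠ a in l, ∀ i, ‖f a i - x i‖ ≤ g i)
    (hf : ∀ i, Tendsto (fun a => f a i) l (𝓝 (x i))) : Tendsto f l (𝓝 x) := by
  have hp0 : 0 < p.toReal := ENNReal.toReal_pos (zero_lt_one.trans_le Fact.out).ne' hp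
  rw [tendsto_iff_norm_sub_tendsto_zero]
  have hsum : Tendsto (fun a => ‖f a - x‖ ^ p.toReal) l (𝓝 0) := by
    simp_rw [lp.norm_rpow_eq_tsum hp0]
    rw [← tsum_zero (α := ℝ) (β := ι)]
    refine tendsto_tsum_of_dominated_convergence (hg.summable hp0) (fun i => ?_) ?_
    · have h := (tendsto_iff_norm_sub_tendsto_zero.1 (hf i)).rpow_const (.inr hp0.le)
      rwa [Real.zero_rpow hp0.ne'] at h
    · filter_upwards [hfg] with a ha i
      rw [Real.norm_of_nonneg (by positivity)]
      exact Real.rpow_le_rpow (norm_nonneg _) ((ha i).trans (Real.le_norm_self _)) hp0.le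
  have h := hsum.rpow_const (p := p.toReal⁻¹) (.inr (inv_nonneg.2 hp0.le))
  rw [Real.zero_rpow (inv_ne_zero hp0.ne')] at h
  exact h.congr fun a => Real.rpow_rpow_inv (norm_nonneg _) hp0.ne'

variable [∀ i, InnerProductSpace ℝ (F i)]

/-- The operator on `ℓ²` which acts by the contraction `T i` on the `i`-th component. -/
def diagCLM (T : ∀ i, F i →L[ℝ] F i) (hT : ∀ i z, ‖T i z‖ ≤ ‖z‖) : lp F 2 →L[ℝ] lp F 2 :=
  LinearMap.mkContinuous
    { toFun x := ⟨fun i => T i (x i), (lp.memℓp x).mono' fun i => hT i (x i)⟩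
      map_add' x y := lp.ext <| funext fun i => map_add (T i) (x i) (y i)
      map_smul' c x := lp.ext <| funext fun i => map_smul (T i) c (x i) }
    1 fun x => by simpa using lp.norm_mono two_ne_zero fun i => hT i (x i)

variable {E : Type*} [NormedAddCommGroup E] [InnerProductSpace ℝ E]

/-- `A` is the orthogonal sum of the bounded operators `B i` in the sense of `Φ : E ≅ ⨁ F i`,
up to the choice of its domain, which has to contain every block `F i`. -/
structure IsBlockDiagonal (Φ : E ≃ₗᵢ[ℝ] lp F 2) (B : ∀ i, F i →L[ℝ] F i) (A : E →ₗ.[ℝ] E) :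
    Prop where
  apply : ∀ (x : A.domain) (i : ι), Φ (A x) i = B i (Φ x i)
  mem_domain : ∀ (x : E) (i : ι), (∀ j, j ≠ i → Φ x j = 0) → x ∈ A.domain

lemma continuous_coord (Φ : E ≃ₗᵢ[ℝ] lp F 2) (i : ι) : Continuous fun x => Φ x i :=
  (lp.evalCLM ℝ F 2 i).continuous.comp Φ.continuous

lemma coord_ext (Φ : E ≃ₗᵢ[ℝ] lp F 2) {x y : E} (h : ∀ i, Φ x i = Φ y i) : x = y :=
  Φ.injective (lp.ext (funext h))

lemma hasSum_symm_single [DecidableEq ι] (Φ : E ≃ₗᵢ[ℝ] lp F 2) (x : E) :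
    HasSum (fun i => Φ.symm (lp.single 2 i (Φ x i))) x := by
  simpa using (lp.hasSum_single (p := 2) (by norm_num) (Φ x)).mapL
    (Φ.symm.toContinuousLinearEquiv : lp F 2 →L[ℝ] E)

namespace IsBlockDiagonal

variable {Φ : E ≃ₗᵢ[ℝ] lp F 2} {B : ∀ i, F i →L[ℝ] F i} {A : E →ₗ.[ℝ] E}

lemma symm_single_mem_domain [DecidableEq ι] (hA : IsBlockDiagonal Φ B A) (i : ι) (z : F i) :
    Φ.symm (lp.single 2 i z) ∈ A.domain :=
  hA.mem_domain _ i fun j hj => by simp [lp.single_apply, hj]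

lemma apply_symm_single [DecidableEq ι] (hA : IsBlockDiagonal Φ B A) (i : ι) (z : F i) :
    A ⟨_, hA.symm_single_mem_domain i z⟩ = Φ.symm (lp.single 2 i (B i z)) := by
  refine coord_ext Φ fun j => ?_
  rw [hA.apply, Φ.apply_symm_apply, Φ.apply_symm_apply]
  obtain rfl | hj := eq_or_ne j i
  · simp
  · simp [lp.single_apply, hj]

lemma dense_domain (hA : IsBlockDiagonal Φ B A) : Dense (A.domain : Set E) := by
  classical
  exact fun x => mem_closure_of_tendsto (hasSum_symm_single Φ x) (.of_forall fun s =>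
    Submodule.sum_mem _ fun i _ => hA.symm_single_mem_domain i _)

lemma isDissipative (hA : IsBlockDiagonal Φ B A) (hB : ∀ i z, ⟪z, B i z⟫_ℝ ≤ 0) :
    IsDissipative A := fun x => by
  rw [← Φ.inner_map_map, lp.inner_eq_tsum]
  exact tsum_nonpos fun i => hA.apply x i ▸ hB i _

lemma mem_closure_graph_iff (hA : IsBlockDiagonal Φ B A) (x y : E) :
    (x, y) ∈ A.graph.topologicalClosure ↔ ∀ i, Φ y i = B i (Φ x i) := by
  classical
  refine ⟨fun hxy i => ?_, fun hxy => ?_⟩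
  · refine closure_minimal (t := {p : E × E | Φ p.2 i = B i (Φ p.1 i)}) ?_
      (isClosed_eq ((continuous_coord Φ i).comp continuous_snd)
        ((B i).continuous.comp ((continuous_coord Φ i).comp continuous_fst))) hxy
    rintro ⟨a, b⟩ hab
    obtain ⟨c, rfl, rfl⟩ := (LinearPMap.mem_graph_iff A).1 hab
    exact hA.apply c i
  · refine mem_closure_of_tendsto ((hasSum_symm_single Φ x).prodMk (hasSum_symm_single Φ y))
      (.of_forall fun s => Submodule.sum_mem _ fun i _ => ?_)
    exact (LinearPMap.mem_graph_iff A).2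
      ⟨⟨_, hA.symm_single_mem_domain i (Φ x i)⟩, rfl, by rw [hA.apply_symm_single, hxy i]⟩

end IsBlockDiagonal

variable [∀ i, CompleteSpace (F i)] {B : ∀ i, F i →L[ℝ] F i}

/-- The semigroup on `E ≅ ⨁ F i` which is `exp (t B i)` on the `i`-th block. Negative times are
cut off at `0`, as `exp (t B i)` need not be bounded uniformly in `i` for them. -/
def blockSemigroup (Φ : E ≃ₗᵢ[ℝ] lp F 2) (hB : ∀ i z, ⟪z, B i z⟫_ℝ ≤ 0) (t : ℝ) : E →L[ℝ] E :=
  (Φ.symm.toContinuousLinearEquiv : lp F 2 →L[ℝ] E).comp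
    ((diagCLM (fun i => NormedSpace.exp (max t 0 • B i)) fun i z =>
      norm_exp_smul_apply_le (hB i) (le_max_right t 0) z).comp
        (Φ.toContinuousLinearEquiv : E →L[ℝ] lp F 2))

variable (Φ : E ≃ₗᵢ[ℝ] lp F 2) (hB : ∀ i z, ⟪z, B i z⟫_ℝ ≤ 0)

lemma blockSemigroup_coord {t : ℝ} (ht : 0 ≤ t) (x : E) (i : ι) :
    Φ (blockSemigroup Φ hB t x) i = NormedSpace.exp (t • B i) (Φ x i) := by
  have h : Φ (blockSemigroup Φ hB t x) i = NormedSpace.exp (max t 0 • B i) (Φ x i) :=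
    congrArg (fun y : lp F 2 => y i) (Φ.apply_symm_apply _)
  rw [h, max_eq_left ht]

lemma isC0Semigroup_blockSemigroup : IsC0Semigroup (blockSemigroup Φ hB) where
  zero := by
    ext x
    refine coord_ext Φ fun i => ?_
    rw [blockSemigroup_coord Φ hB le_rfl, zero_smul, NormedSpace.exp_zero]
    rfl
  add s t hs ht := by
    ext x
    refine coord_ext Φ fun i => ?_
    rw [ContinuousLinearMap.comp_apply, blockSemigroup_coord Φ hB (add_nonneg hs ht),
      blockSemigroup_coord Φ hB hs, blockSemigroup_coord Φ hB ht, exp_add_smul]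
    rfl
  continuousOn x t ht := by
    refine Φ.isometry.isEmbedding.tendsto_nhds_iff.2 (tendsto_lp_of_dominated
      (g := fun i => 2 * ‖Φ x i‖) (by simp) ((memℓp_norm_iff.2 (lp.memℓp (Φ x))).const_mul 2)
      ?_ fun i => ?_)
    · filter_upwards [self_mem_nhdsWithin] with s hs i
      rw [Function.comp_apply, blockSemigroup_coord Φ hB hs, blockSemigroup_coord Φ hB ht,
        two_mul]
      exact (norm_sub_le _ _).trans (add_le_add (norm_exp_smul_apply_le (hB i) hs _)
        (norm_exp_smul_apply_le (hB i) ht _))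
    · rw [blockSemigroup_coord Φ hB ht]
      refine ((hasDerivAt_exp_smul_apply (B i) (Φ x i) t).continuousAt.mono_left
        nhdsWithin_le_nhds).congr' ?_
      filter_upwards [self_mem_nhdsWithin] with s hs
      rw [Function.comp_apply, blockSemigroup_coord Φ hB hs]

lemma blockSemigroup_slope_coord {t : ℝ} (ht : 0 ≤ t) (x : E) (i : ι) :
    Φ (t⁻¹ • (blockSemigroup Φ hB t x - x)) i =
      t⁻¹ • (NormedSpace.exp (t • B i) (Φ x i) - Φ x i) := by
  rw [← blockSemigroup_coord Φ hB ht, map_smul, map_sub]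
  rfl

lemma tendsto_blockSemigroup_slope_coord (x : E) (i : ι) :
    Tendsto (fun t : ℝ => Φ (t⁻¹ • (blockSemigroup Φ hB t x - x)) i) (𝓝[>] 0)
      (𝓝 (B i (Φ x i))) := by
  refine (tendsto_exp_smul_slope (B i) (Φ x i)).congr' ?_
  filter_upwards [self_mem_nhdsWithin] with t (ht : 0 < t)
  rw [blockSemigroup_slope_coord Φ hB ht.le]

lemma tendsto_blockSemigroup_slope_iff (x y : E) :
    Tendsto (fun t : ℝ => t⁻¹ • (blockSemigroup Φ hB t x - x)) (𝓝[>] 0) (𝓝 y) ↔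
      ∀ i, Φ y i = B i (Φ x i) := by
  have hlim := tendsto_blockSemigroup_slope_coord Φ hB x
  refine ⟨fun h i => tendsto_nhds_unique (((continuous_coord Φ i).tendsto y).comp h) (hlim i),
    fun h => Φ.isometry.isEmbedding.tendsto_nhds_iff.2 (tendsto_lp_of_dominated
      (g := fun i => 2 * ‖Φ y i‖) (by simp) ((memℓp_norm_iff.2 (lp.memℓp (Φ y))).const_mul 2)
      ?_ fun i => h i ▸ hlim i)⟩
  filter_upwards [self_mem_nhdsWithin] with t (ht : 0 < t) i
  rw [Function.comp_apply, blockSemigroup_slope_coord Φ hB ht.le, two_mul]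
  refine (norm_sub_le _ _).trans (add_le_add_left ?_ _)
  rw [norm_smul, norm_inv, Real.norm_of_nonneg ht.le, inv_mul_le_iff₀ ht, h i, mul_comm]
  exact norm_exp_smul_apply_sub_le (hB i) ht.le _

theorem IsBlockDiagonal.generates_blockSemigroup {A : E →ₗ.[ℝ] E}
    (hA : IsBlockDiagonal Φ B A) : Generates A (blockSemigroup Φ hB) :=
  ⟨isC0Semigroup_blockSemigroup Φ hB, fun x y => by
    rw [hA.mem_closure_graph_iff, tendsto_blockSemigroup_slope_iff]⟩

end BlockDiagonal

/-! ### Eigenvectors and their powers -/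

section Eigenvectors

universe u

lemma hilbertBasis_ext {E ι : Type*} [NormedAddCommGroup E] [InnerProductSpace ℝ E]
    (b : HilbertBasis ι ℝ E) {x y : E} (h : ∀ i, ⟪b i, x⟫_ℝ = ⟪b i, y⟫_ℝ) : x = y :=
  b.repr.injective <| lp.ext <| funext fun i => by
    rw [b.repr_apply_apply, b.repr_apply_apply, h]

variable {E : Type*} [NormedAddCommGroup E] [InnerProductSpace ℝ E]

lemma inner_eq_zero_of_mem_eigenspace {A : E →ₗ.[ℝ] E} (hA : A.IsFormalAdjoint A) {m k : ℝ}
    (hmk : m ≠ k) {x y : E} (hx : x ∈ eigenspace A m) (hy : y ∈ eigenspace A k) :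
    ⟪x, y⟫_ℝ = 0 := by
  obtain ⟨hx, hAx⟩ := hx
  obtain ⟨hy, hAy⟩ := hy
  have h : m * ⟪x, y⟫_ℝ = k * ⟪x, y⟫_ℝ := by
    rw [← real_inner_smul_left, ← real_inner_smul_right, ← hAx, ← hAy]
    exact hA ⟨x, hx⟩ ⟨y, hy⟩
  exact (mul_eq_mul_right_iff.1 h).resolve_left hmk

section Powers

variable [CompleteSpace E] {A : E →ₗ.[ℝ] E} {m : ℝ} {x : E}

lemma eigenproj_of_ne (hA : A.IsFormalAdjoint A) (hx : x ∈ eigenspace A m) {k : ℝ}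
    (hk : k ≠ m) : eigenproj A k x = 0 := by
  refine (Submodule.starProjection_apply_eq_zero_iff _).2 ?_
  rw [Submodule.orthogonal_closure]
  exact (Submodule.mem_orthogonal _ _).2 fun y hy =>
    inner_eq_zero_of_mem_eigenspace hA hk hy hx

lemma hasSum_fracPow_of_mem_eigenspace (hA : A.IsFormalAdjoint A) (hx : x ∈ eigenspace A m)
    (s : ℝ) : HasSum (fun k : ℝ => k ^ s • eigenproj A k x) (m ^ s • x) := by
  have h := hasSum_single (f := fun k : ℝ => k ^ s • eigenproj A k x) m
    fun k hk => by rw [eigenproj_of_ne hA hx hk, smul_zero]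
  rwa [eigenproj_of_mem hx] at h

lemma mem_fracPow_domain_of_mem_eigenspace (hA : A.IsFormalAdjoint A)
    (hx : x ∈ eigenspace A m) (s : ℝ) : x ∈ (fracPow A s).domain :=
  (hasSum_fracPow_of_mem_eigenspace hA hx s).summable

lemma fracPow_of_mem_eigenspace (hA : A.IsFormalAdjoint A) (hx : x ∈ eigenspace A m) (s : ℝ) :
    fracPow A s ⟨x, mem_fracPow_domain_of_mem_eigenspace hA hx s⟩ = m ^ s • x :=
  (hasSum_fracPow_of_mem_eigenspace hA hx s).tsum_eq

lemma inner_fracPow_of_mem_eigenspace (hA : A.IsFormalAdjoint A) (hx : x ∈ eigenspace A m)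
    {s : ℝ} (w : (fracPow A s).domain) : ⟪x, fracPow A s w⟫_ℝ = m ^ s * ⟪x, (w : E)⟫_ℝ := by
  have hw : HasSum (fun k : ℝ => k ^ s • eigenproj A k (w : E)) (fracPow A s w) :=
    Summable.hasSum w.2
  have h₁ := hw.mapL (innerSL ℝ x)
  have h₂ := (hasSum_fracPow_of_mem_eigenspace hA hx s).mapL (innerSL ℝ (w : E))
  simp only [innerSL_apply_apply, real_inner_smul_right] at h₁ h₂
  rw [real_inner_comm x] at h₂
  refine h₁.unique (h₂.congr_fun fun k => ?_)
  rw [← eigenproj_inner, real_inner_comm]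

end Powers

/-- A Hilbert basis which consists of eigenvectors of `A`, with the eigenvalue of each of them. -/
structure Eigenbasis (A : E →ₗ.[ℝ] E) (ι : Type*) where
  basis : HilbertBasis ι ℝ E
  eigenvalue : ι → ℝ
  mem_eigenspace : ∀ i, basis i ∈ eigenspace A (eigenvalue i)

lemma IsAdmissible.isFormalAdjoint [CompleteSpace E] {L : E →ₗ.[ℝ] E} (hL : IsAdmissible L) :
    L.IsFormalAdjoint L :=
  hL.symm

lemma IsAdmissible.exists_eigenbasis {E : Type u} [NormedAddCommGroup E] [InnerProductSpace ℝ E]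
    [CompleteSpace E] {L : E →ₗ.[ℝ] E} (hL : IsAdmissible L) :
    ∃ ι : Type u, Nonempty (Eigenbasis L ι) := by
  have hclosed (m : ℝ) : CompleteSpace (eigenspace L m) := by
    rw [← hL.closure_eigenspace m]
    infer_instance
  choose w b _ using fun m => exists_hilbertBasis ℝ (eigenspace L m)
  have hortho := hL.orthogonalFamily.orthonormal_sigma_orthonormal fun m => (b m).orthonormal
  have htotal : (Submodule.span ℝ (range fun a : Σ m, w m =>
      (eigenspace L a.1).subtypeₗᵢ (b a.1 a.2)))ᗮ = ⊥ := by
    refine (Submodule.eq_bot_iff _).2 fun x hx => hL.eq_of_eigenproj fun m => ?_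
    rw [map_zero]
    refine congrArg Subtype.val (hilbertBasis_ext (b m)
      (x := ⟨eigenproj L m x, hL.eigenproj_mem m x⟩) (y := 0) fun i => ?_)
    rw [inner_zero_right, Submodule.coe_inner, ← eigenproj_inner, eigenproj_of_mem (b m i).2]
    exact (Submodule.mem_orthogonal _ _).1 hx _ (Submodule.subset_span ⟨⟨m, i⟩, rfl⟩)
  refine ⟨Σ m, w m, ⟨⟨HilbertBasis.mkOfOrthogonalEqBot hortho htotal, Sigma.fst, fun a => ?_⟩⟩⟩
  rw [HilbertBasis.coe_mkOfOrthogonalEqBot]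
  exact (b a.1 a.2).2

end Eigenvectors

/-! ### The trace of the inverse -/

section Trace

variable {E ι : Type*} [NormedAddCommGroup E] [InnerProductSpace ℝ E]

lemma sum_abs_inner_mul_le {e : ι → E} (he : Orthonormal ℝ e) (s : Finset ι) (x y : E) :
    ∑ i ∈ s, |⟪e i, x⟫_ℝ * ⟪e i, y⟫_ℝ| ≤ ‖x‖ * ‖y‖ := by
  have bessel (z : E) : ∑ i ∈ s, |⟪e i, z⟫_ℝ| ^ 2 ≤ ‖z‖ ^ 2 := by
    simpa only [Real.norm_eq_abs] using he.sum_inner_products_le z (s := s)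
  calc ∑ i ∈ s, |⟪e i, x⟫_ℝ * ⟪e i, y⟫_ℝ|
      = ∑ i ∈ s, |⟪e i, x⟫_ℝ| * |⟪e i, y⟫_ℝ| := by simp only [abs_mul]
    _ ≤ √(∑ i ∈ s, |⟪e i, x⟫_ℝ| ^ 2) * √(∑ i ∈ s, |⟪e i, y⟫_ℝ| ^ 2) :=
      Real.sum_mul_le_sqrt_mul_sqrt _ _ _
    _ ≤ √(‖x‖ ^ 2) * √(‖y‖ ^ 2) := by
      gcongr <;> exact bessel _
    _ = ‖x‖ * ‖y‖ := by
      rw [Real.sqrt_sq (norm_nonneg _), Real.sqrt_sq (norm_nonneg _)]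

lemma IsTraceClass.summable_inner {T : E →L[ℝ] E} (hT : IsTraceClass T) {e : ι → E}
    (he : Orthonormal ℝ e) : Summable fun i => ⟪e i, T (e i)⟫_ℝ := by
  obtain ⟨a, b, hab, hT⟩ := hT
  have hsum (i : ι) : HasSum (fun n => ⟪e i, a n⟫_ℝ * ⟪e i, b n⟫_ℝ) ⟪e i, T (e i)⟫_ℝ := by
    simpa [real_inner_smul_right, real_inner_comm (e i) (a _)] using
      (hT (e i)).mapL (innerSL ℝ (e i))
  have habs (n : ℕ) : Summable fun i => |⟪e i, a n⟫_ℝ * ⟪e i, b n⟫_ℝ| :=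
    summable_of_sum_le (fun _ => abs_nonneg _) fun s => sum_abs_inner_mul_le he s (a n) (b n)
  have hprod : Summable fun p : ℕ × ι => |⟪e p.2, a p.1⟫_ℝ * ⟪e p.2, b p.1⟫_ℝ| :=
    (summable_prod_of_nonneg fun _ => abs_nonneg _).2 ⟨habs, hab.of_nonneg_of_le
      (fun n => tsum_nonneg fun _ => abs_nonneg _)
      fun n => (habs n).tsum_le_of_sum_le fun s => sum_abs_inner_mul_le he s (a n) (b n)⟩
  exact ((hprod.of_abs.prod_symm.prod).congr fun i => (hsum i).tsum_eq)

variable [CompleteSpace E] {L : E →ₗ.[ℝ] E} (hL : IsAdmissible L) (e : Eigenbasis L ι)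

include hL in
lemma IsAdmissible.eigenvalue_pos (i : ι) : 0 < e.eigenvalue i := by
  by_contra h
  exact e.basis.orthonormal.ne_zero i (hL.pos (e.mem_eigenspace i) (not_lt.1 h))

include hL in
lemma IsAdmissible.summable_inv_eigenvalue : Summable fun i => (e.eigenvalue i)⁻¹ := by
  obtain ⟨K, hK, htrace⟩ := hL.inverse
  refine (htrace.summable_inner e.basis.orthonormal).congr fun i => ?_
  obtain ⟨hdom, hLe⟩ := e.mem_eigenspace i
  have hKe : K (e.basis i) = (e.eigenvalue i)⁻¹ • e.basis i := by
    rw [eq_inv_smul_iff₀ (hL.eigenvalue_pos e i).ne', ← map_smul, ← hLe]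
    exact hK.1 ⟨e.basis i, hdom⟩
  rw [hKe, real_inner_smul_right, real_inner_self_eq_norm_sq, e.basis.orthonormal.norm_eq_one,
    one_pow, mul_one]

end Trace

/-! ### Coordinates in `V'` and in `H` -/

section Coordinates

lemma eq_smul_of_inner_eq_zero {E ι : Type*} [NormedAddCommGroup E] [InnerProductSpace ℝ E]
    (b : HilbertBasis ι ℝ E) {x : E} {i : ι} (h : ∀ j, j ≠ i → ⟪b j, x⟫_ℝ = 0) :
    x = ⟪b i, x⟫_ℝ • b i := by
  refine hilbertBasis_ext b fun j => ?_
  rw [real_inner_smul_right]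
  obtain rfl | hj := eq_or_ne j i
  · rw [real_inner_self_eq_norm_sq, b.orthonormal.norm_eq_one, one_pow, mul_one]
  · rw [b.orthonormal.inner_eq_zero hj, mul_zero, h j hj]

lemma memℓp_complex_iff {ι : Type*} {p : ℝ≥0∞} {z : ι → ℂ} :
    Memℓp z p ↔ Memℓp (fun i => (z i).re) p ∧ Memℓp (fun i => (z i).im) p := by
  refine ⟨fun h => ⟨h.mono' fun i => Complex.abs_re_le_norm _,
    h.mono' fun i => Complex.abs_im_le_norm _⟩, fun ⟨hre, him⟩ => ?_⟩
  have hre' : Memℓp (fun i => ((z i).re : ℂ)) p := hre.mono' fun i => (Complex.norm_real _).le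
  have him' : Memℓp (fun i => ((z i).im * Complex.I : ℂ)) p := him.mono' fun i => by simp
  exact (hre'.add him').mono' fun i => by simp [Complex.re_add_im]

/-- The coordinates of a pair with respect to two Hilbert bases with the same index set; the
coefficients of the two components are the real and the imaginary parts. -/
def pairCoords {ι E F : Type*} [NormedAddCommGroup E] [InnerProductSpace ℝ E]
    [NormedAddCommGroup F] [InnerProductSpace ℝ F] (b : HilbertBasis ι ℝ E)
    (c : HilbertBasis ι ℝ F) : WithLp 2 (E × F) ≃ₗᵢ[ℝ] lp (fun _ : ι => ℂ) 2 :=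
  LinearEquiv.isometryOfInner
    { toFun x := ⟨fun i => ⟨b.repr x.fst i, c.repr x.snd i⟩,
        memℓp_complex_iff.2 ⟨lp.memℓp (b.repr x.fst), lp.memℓp (c.repr x.snd)⟩⟩
      map_add' x y := lp.ext <| funext fun i => Complex.ext
        (congrFun (congrArg Subtype.val (b.repr.map_add x.fst y.fst)) i)
        (congrFun (congrArg Subtype.val (c.repr.map_add x.snd y.snd)) i)
      map_smul' r x := lp.ext <| funext fun i => Complex.ext (by simp) (by simp)
      invFun z := WithLp.toLp 2
        (b.repr.symm ⟨fun i => (z i).re, (memℓp_complex_iff.1 (lp.memℓp z)).1⟩,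
          c.repr.symm ⟨fun i => (z i).im, (memℓp_complex_iff.1 (lp.memℓp z)).2⟩)
      left_inv x := WithLp.ofLp_injective 2 <|
        Prod.ext (b.repr.symm_apply_apply _) (c.repr.symm_apply_apply _)
      right_inv z := by ext i; simp }
    fun x y => by
      rw [WithLp.prod_inner_apply, ← b.repr.inner_map_map, ← c.repr.inner_map_map]
      refine (lp.hasSum_inner _ _).unique
        (((lp.hasSum_inner _ _).add (lp.hasSum_inner _ _)).congr_fun fun i => ?_)
      simp [Complex.inner, mul_comm]

variable {U : Type*} [NormedAddCommGroup U] [InnerProductSpace ℝ U] [CompleteSpace U]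
  {L : U →ₗ.[ℝ] U} (hL : IsAdmissible L)

lemma exists_lapl_eq (g : DualV hL) : ∃ v, lapl hL v = g :=
  ⟨(InnerProductSpace.toDual ℝ (V hL)).symm g,
    (InnerProductSpace.toDual ℝ (V hL)).apply_symm_apply g⟩

lemma inner_lapl_left (v : V hL) (g : DualV hL) :
    ⟪lapl hL v, g⟫_ℝ = DualV.equiv hL g v := by
  have h : (InnerProductSpace.toDual ℝ (V hL)).symm (lapl hL v) = v :=
    (InnerProductSpace.toDual ℝ (V hL)).symm_apply_apply v
  change ⟪(InnerProductSpace.toDual ℝ (V hL)).symm (lapl hL v),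
    (InnerProductSpace.toDual ℝ (V hL)).symm g⟫_ℝ = _
  rw [h, real_inner_comm]
  exact InnerProductSpace.toDual_symm_apply

lemma inner_lapl_emb (v : V hL) (u : U) :
    ⟪lapl hL v, emb hL u⟫_ℝ = ⟪V.val hL v, u⟫_ℝ := by
  rw [inner_lapl_left, emb_apply, real_inner_comm]
  rfl

lemma extOp_embV (v : V hL) (h : embV hL v ∈ (extOp hL).domain) :
    extOp hL ⟨embV hL v, h⟩ = lapl hL v :=
  congrArg (lapl hL) ((LinearEquiv.symm_apply_eq _).2 rfl)

lemma exists_extOp_eq_lapl (x : (extOp hL).domain) :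
    ∃ v, embV hL v = x ∧ extOp hL x = lapl hL v := by
  obtain ⟨_, v, rfl⟩ := x
  exact ⟨v, rfl, extOp_embV hL v _⟩

lemma isFormalAdjoint_extOp : (extOp hL).IsFormalAdjoint (extOp hL) := by
  intro x y
  obtain ⟨v, hvx, hv⟩ := exists_extOp_eq_lapl hL x
  obtain ⟨w, hwy, hw⟩ := exists_extOp_eq_lapl hL y
  calc ⟪extOp hL x, (y : DualV hL)⟫_ℝ
      = ⟪V.val hL v, V.val hL w⟫_ℝ := by rw [hv, ← hwy]; exact inner_lapl_emb hL v _
    _ = ⟪V.val hL w, V.val hL v⟫_ℝ := real_inner_comm _ _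
    _ = ⟪(x : DualV hL), extOp hL y⟫_ℝ := by
      rw [hw, ← hvx, real_inner_comm (lapl hL w)]; exact (inner_lapl_emb hL w _).symm

variable {m : ℝ} {x : U}

lemma exists_lapl_eq_smul_emb (hx : x ∈ eigenspace L m) :
    ∃ v : V hL, V.val hL v = x ∧ lapl hL v = m • emb hL x := by
  rcases le_or_gt m 0 with hm | hm
  · obtain rfl := hL.pos hx hm
    exact ⟨0, map_zero _, by rw [map_zero, map_zero, smul_zero]⟩
  let v : V hL := ⟨x, mem_fracPow_domain_of_mem_eigenspace hL.isFormalAdjoint hx _⟩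
  refine ⟨v, rfl, (DualV.equiv hL).injective (ContinuousLinearMap.ext fun w => ?_)⟩
  have hv : V.half hL v = m ^ (1 / 2 : ℝ) • x :=
    fracPow_of_mem_eigenspace hL.isFormalAdjoint hx _
  have hw : ⟪x, V.half hL w⟫_ℝ = m ^ (1 / 2 : ℝ) * ⟪x, V.incl hL w⟫_ℝ :=
    inner_fracPow_of_mem_eigenspace hL.isFormalAdjoint hx w
  rw [lapl_apply, V.inner_def, hv, map_smul, smul_apply, emb_apply, real_inner_smul_left,
    smul_eq_mul, hw, ← mul_assoc, ← Real.rpow_add hm, add_halves, Real.rpow_one]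

lemma emb_mem_eigenspace (hx : x ∈ eigenspace L m) : emb hL x ∈ eigenspace (extOp hL) m := by
  obtain ⟨v, rfl, hv⟩ := exists_lapl_eq_smul_emb hL hx
  exact ⟨⟨v, rfl⟩, (extOp_embV hL v _).trans hv⟩

lemma inner_emb_emb (hm : m ≠ 0) (hx : x ∈ eigenspace L m) (u : U) :
    ⟪emb hL x, emb hL u⟫_ℝ = m⁻¹ * ⟪x, u⟫_ℝ := by
  obtain ⟨v, rfl, hv⟩ := exists_lapl_eq_smul_emb hL hx
  rw [eq_inv_mul_iff_mul_eq₀ hm, ← real_inner_smul_left, ← hv, inner_lapl_emb]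

variable {ι : Type*} (e : Eigenbasis L ι)

lemma orthonormal_smul_emb :
    Orthonormal ℝ fun i => √(e.eigenvalue i) • emb hL (e.basis i) := by
  classical
  rw [orthonormal_iff_ite]
  intro i j
  have hpos := hL.eigenvalue_pos e i
  rw [real_inner_smul_left, real_inner_smul_right,
    inner_emb_emb hL hpos.ne' (e.mem_eigenspace i), orthonormal_iff_ite.1 e.basis.orthonormal i j]
  split_ifs with h
  · subst h
    rw [mul_one, ← mul_assoc, Real.mul_self_sqrt hpos.le, mul_inv_cancel₀ hpos.ne']
  · simp only [mul_zero]

lemma orthogonal_span_smul_emb :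
    (Submodule.span ℝ (range fun i => √(e.eigenvalue i) • emb hL (e.basis i)))ᗮ = ⊥ := by
  refine (Submodule.eq_bot_iff _).2 fun g hg => ?_
  obtain ⟨v, rfl⟩ := exists_lapl_eq hL g
  have hv : V.val hL v = 0 := by
    refine hilbertBasis_ext e.basis fun i => ?_
    have h := (Submodule.mem_orthogonal _ _).1 hg _ (Submodule.subset_span ⟨i, rfl⟩)
    rw [real_inner_smul_left, real_inner_comm, inner_lapl_emb, real_inner_comm] at h
    rw [inner_zero_right]
    exact (mul_eq_zero.1 h).resolve_left (Real.sqrt_pos.2 (hL.eigenvalue_pos e i)).ne'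
  rw [show v = 0 from Subtype.ext hv, map_zero]

/-- The basis of eigenvectors `√μ • e` of the extension of `Λ` to `V'`, for the eigenvectors `e`
of `Λ` with eigenvalue `μ`; the factor normalizes them in `V'`. -/
def dualEigenbasis : Eigenbasis (extOp hL) ι where
  basis := HilbertBasis.mkOfOrthogonalEqBot (orthonormal_smul_emb hL e)
    (orthogonal_span_smul_emb hL e)
  eigenvalue := e.eigenvalue
  mem_eigenspace i := by
    rw [HilbertBasis.coe_mkOfOrthogonalEqBot]
    exact Submodule.smul_mem _ _ (emb_mem_eigenspace hL (e.mem_eigenspace i))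

lemma dualEigenbasis_basis (i : ι) :
    (dualEigenbasis hL e).basis i = √(e.eigenvalue i) • emb hL (e.basis i) :=
  congrFun (HilbertBasis.coe_mkOfOrthogonalEqBot (orthonormal_smul_emb hL e)
    (orthogonal_span_smul_emb hL e)) i

lemma sqrt_mul_inner_dualEigenbasis_emb (i : ι) (u : U) :
    √(e.eigenvalue i) * ⟪(dualEigenbasis hL e).basis i, emb hL u⟫_ℝ = ⟪e.basis i, u⟫_ℝ := by
  have hpos := hL.eigenvalue_pos e i
  rw [dualEigenbasis_basis, real_inner_smul_left,
    inner_emb_emb hL hpos.ne' (e.mem_eigenspace i), ← mul_assoc,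
    Real.mul_self_sqrt hpos.le, mul_inv_cancel_left₀ hpos.ne']

lemma inner_dualEigenbasis_lapl (i : ι) (v : V hL) :
    ⟪(dualEigenbasis hL e).basis i, lapl hL v⟫_ℝ
      = √(e.eigenvalue i) * ⟪e.basis i, V.val hL v⟫_ℝ := by
  rw [dualEigenbasis_basis, real_inner_smul_left, real_inner_comm, inner_lapl_emb,
    real_inner_comm]

/-- The coordinates of `(x₁, x₂) ∈ H` with respect to the eigenvectors of `Λ`: those of `x₁` are
the real parts, those of `x₂` the imaginary parts. -/
def waveCoords : H hL ≃ₗᵢ[ℝ] lp (fun _ : ι => ℂ) 2 :=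
  pairCoords e.basis (dualEigenbasis hL e).basis

lemma waveCoords_re (x : H hL) (i : ι) :
    (waveCoords hL e x i).re = ⟪e.basis i, H.fst hL x⟫_ℝ :=
  e.basis.repr_apply_apply _ _

lemma waveCoords_im (x : H hL) (i : ι) :
    (waveCoords hL e x i).im = ⟪(dualEigenbasis hL e).basis i, H.snd hL x⟫_ℝ :=
  (dualEigenbasis hL e).basis.repr_apply_apply _ _

end Coordinates

/-! ### The damped wave operator in coordinates -/

section WaveOperator

/-- The matrix `[[0, ω], [-ω, -r]]` of the oscillator with frequency `ω` and damping `r`, on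
`ℂ = ℝ²`. -/
def oscillator (ω r : ℝ) : ℂ →L[ℝ] ℂ :=
  (ω • Complex.imCLM).smulRight 1 - (ω • Complex.reCLM + r • Complex.imCLM).smulRight Complex.I

lemma oscillator_apply_re (ω r : ℝ) (z : ℂ) : (oscillator ω r z).re = ω * z.im := by
  simp [oscillator]

lemma oscillator_apply_im (ω r : ℝ) (z : ℂ) :
    (oscillator ω r z).im = -(ω * z.re) - r * z.im := by
  simp [oscillator, sub_eq_add_neg, add_comm]

lemma inner_oscillator_nonpos (ω : ℝ) {r : ℝ} (hr : 0 ≤ r) (z : ℂ) :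
    ⟪z, oscillator ω r z⟫_ℝ ≤ 0 := by
  have h : ⟪z, oscillator ω r z⟫_ℝ = -(r * z.im ^ 2) := by
    rw [Complex.inner, Complex.mul_re, Complex.conj_re, Complex.conj_im, oscillator_apply_re,
      oscillator_apply_im]
    ring
  rw [h]
  exact neg_nonpos.2 (by positivity)

variable {U ι : Type*} [NormedAddCommGroup U] [InnerProductSpace ℝ U] [CompleteSpace U]
  {L : U →ₗ.[ℝ] U} (hL : IsAdmissible L) {α ρ : ℝ}

lemma emb_domSnd (x : waveDomain hL α) : emb hL (domSnd hL α x) = H.snd hL x :=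
  congrArg Subtype.val (LinearEquiv.apply_symm_apply
    (LinearEquiv.ofInjective (emb hL).toLinearMap (emb_injective hL)) ⟨H.snd hL x, x.2.2.1⟩)

variable (e : Eigenbasis L ι)

lemma waveCoords_waveOp (x : (waveOp hL α ρ).domain) (i : ι) :
    waveCoords hL e (waveOp hL α ρ x) i =
      oscillator √(e.eigenvalue i) (ρ * e.eigenvalue i ^ α) (waveCoords hL e x i) := by
  have hfst : H.fst hL (waveOp hL α ρ x) = domSnd hL α x := rfl
  have hsnd : H.snd hL (waveOp hL α ρ x) =
    -(lapl hL (domFst hL α x)) - ρ • domPow hL α x := rfl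
  have hval : V.val hL (domFst hL α x) = H.fst hL x := rfl
  have hpow : ⟪(dualEigenbasis hL e).basis i, domPow hL α x⟫_ℝ =
      e.eigenvalue i ^ α * ⟪(dualEigenbasis hL e).basis i, H.snd hL x⟫_ℝ :=
    inner_fracPow_of_mem_eigenspace (isFormalAdjoint_extOp hL)
      ((dualEigenbasis hL e).mem_eigenspace i) ⟨H.snd hL x, x.2.2.2⟩
  refine Complex.ext ?_ ?_
  · rw [waveCoords_re, oscillator_apply_re, waveCoords_im, hfst, ← emb_domSnd hL x,
      sqrt_mul_inner_dualEigenbasis_emb]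
  · rw [waveCoords_im, oscillator_apply_im, waveCoords_im, waveCoords_re, hsnd, inner_sub_right,
      inner_neg_right, real_inner_smul_right, hpow, inner_dualEigenbasis_lapl, hval, mul_assoc]

lemma mem_waveDomain_of_waveCoords_eq_zero (x : H hL) (i : ι)
    (h : ∀ j, j ≠ i → waveCoords hL e x j = 0) : x ∈ waveDomain hL α := by
  have hfst : H.fst hL x = ⟪e.basis i, H.fst hL x⟫_ℝ • e.basis i :=
    eq_smul_of_inner_eq_zero e.basis fun j hj => by
      rw [← waveCoords_re, h j hj, Complex.zero_re]
  have hsnd : H.snd hL x = ⟪(dualEigenbasis hL e).basis i, H.snd hL x⟫_ℝ •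
      (dualEigenbasis hL e).basis i :=
    eq_smul_of_inner_eq_zero (dualEigenbasis hL e).basis fun j hj => by
      rw [← waveCoords_im, h j hj, Complex.zero_im]
  refine ⟨?_, ?_, ?_⟩
  · rw [SetLike.mem_coe, Submodule.mem_comap, hfst]
    exact Submodule.smul_mem _ _
      (mem_fracPow_domain_of_mem_eigenspace hL.isFormalAdjoint (e.mem_eigenspace i) _)
  · rw [SetLike.mem_coe, Submodule.mem_comap, hsnd, dualEigenbasis_basis]
    exact Submodule.smul_mem _ _ (Submodule.smul_mem _ _ ⟨e.basis i, rfl⟩)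
  · rw [SetLike.mem_coe, Submodule.mem_comap, hsnd]
    exact Submodule.smul_mem _ _ (mem_fracPow_domain_of_mem_eigenspace
      (isFormalAdjoint_extOp hL) ((dualEigenbasis hL e).mem_eigenspace i) _)

lemma isBlockDiagonal_waveOp :
    IsBlockDiagonal (waveCoords hL e)
      (fun i => oscillator √(e.eigenvalue i) (ρ * e.eigenvalue i ^ α)) (waveOp hL α ρ) :=
  ⟨waveCoords_waveOp hL e, mem_waveDomain_of_waveCoords_eq_zero hL e⟩

include hL in
lemma inner_oscillator_eigenvalue_nonpos (hρ : 0 ≤ ρ) (i : ι) (z : ℂ) :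
    ⟪z, oscillator √(e.eigenvalue i) (ρ * e.eigenvalue i ^ α) z⟫_ℝ ≤ 0 :=
  inner_oscillator_nonpos _ (mul_nonneg hρ (Real.rpow_nonneg (hL.eigenvalue_pos e i).le α)) z

theorem exists_generates_waveOp (hρ : 0 ≤ ρ) :
    ∃ S : ℝ → H hL →L[ℝ] H hL, Generates (waveOp hL α ρ) S := by
  obtain ⟨ι, ⟨e⟩⟩ := hL.exists_eigenbasis
  exact ⟨_, (isBlockDiagonal_waveOp hL e).generates_blockSemigroup _
    (inner_oscillator_eigenvalue_nonpos hL e hρ)⟩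

theorem norm_apply_le_of_generates_waveOp (hρ : 0 ≤ ρ) {S : ℝ → H hL →L[ℝ] H hL}
    (hS : Generates (waveOp hL α ρ) S) {t : ℝ} (ht : 0 ≤ t) (x : H hL) : ‖S t x‖ ≤ ‖x‖ := by
  obtain ⟨ι, ⟨e⟩⟩ := hL.exists_eigenbasis
  have hA := isBlockDiagonal_waveOp hL e (α := α) (ρ := ρ)
  exact hS.norm_apply_le
    (hA.isDissipative (inner_oscillator_eigenvalue_nonpos hL e hρ)) hA.dense_domain ht x

end WaveOperator

/-! ### Hilbert-Schmidt operators -/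

section HilbertSchmidt

variable {U E F ι κ : Type*} [NormedAddCommGroup U] [InnerProductSpace ℝ U]

lemma enorm_sq_eq_ofReal_norm_sq [NormedAddCommGroup F] (x : F) :
    ‖x‖ₑ ^ 2 = ENNReal.ofReal (‖x‖ ^ 2) := by
  rw [ENNReal.ofReal_pow (norm_nonneg _), ofReal_norm]

lemma enorm_add_sq_le [NormedAddCommGroup F] (x y : F) :
    ‖x + y‖ₑ ^ 2 ≤ 2 * ‖x‖ₑ ^ 2 + 2 * ‖y‖ₑ ^ 2 := by
  simp only [enorm_sq_eq_ofReal_norm_sq]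
  rw [← ENNReal.ofReal_ofNat 2, ← ENNReal.ofReal_mul zero_le_two,
    ← ENNReal.ofReal_mul zero_le_two, ← ENNReal.ofReal_add (by positivity) (by positivity)]
  refine ENNReal.ofReal_le_ofReal ?_
  nlinarith [norm_add_le x y, norm_nonneg (x + y), sq_nonneg (‖x‖ - ‖y‖)]

variable [NormedAddCommGroup E] [InnerProductSpace ℝ E]

lemma norm_sum_smul_sq [Fintype κ] (c : κ → ℝ) (y : κ → E) :
    ‖∑ i, c i • y i‖ ^ 2 = ∑ i, ∑ j, c i * c j * ⟪y i, y j⟫_ℝ := by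
  simp only [← real_inner_self_eq_norm_sq, sum_inner, inner_sum, real_inner_smul_left,
    real_inner_smul_right, mul_assoc]
  exact Finset.sum_congr rfl fun i _ => Finset.sum_congr rfl fun j _ => by rw [real_inner_comm]

lemma hasSum_norm_sum_smulRight_sq [Fintype κ] (b : HilbertBasis ι ℝ U) (c : κ → ℝ)
    (u : κ → U) (y : κ → E) :
    HasSum (fun k => ‖(∑ i, c i • (innerSL ℝ (u i)).smulRight (y i)) (b k)‖ ^ 2)
      (∑ i, ∑ j, c i * c j * (⟪u i, u j⟫_ℝ * ⟪y i, y j⟫_ℝ)) := by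
  have hcoef : ∀ i j, HasSum
      (fun k => c i * c j * (⟪u i, b k⟫_ℝ * ⟪b k, u j⟫_ℝ * ⟪y i, y j⟫_ℝ))
      (c i * c j * (⟪u i, u j⟫_ℝ * ⟪y i, y j⟫_ℝ)) := fun i j =>
    ((b.hasSum_inner_mul_inner (u i) (u j)).mul_right _).mul_left _
  refine (hasSum_sum fun i _ => hasSum_sum fun j _ => hcoef i j).congr_fun fun k => ?_
  have happly : (∑ i, c i • (innerSL ℝ (u i)).smulRight (y i)) (b k)
      = ∑ i, (c i * ⟪u i, b k⟫_ℝ) • y i := by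
    simp [smul_smul]
  rw [happly, norm_sum_smul_sq]
  refine Finset.sum_congr rfl fun i _ => Finset.sum_congr rfl fun j _ => ?_
  rw [real_inner_comm (u j)]
  ring

variable [CompleteSpace U]

lemma hsNorm_neg [NormedAddCommGroup F] [NormedSpace ℝ F] (T : U →L[ℝ] F) :
    hsNorm (-T) = hsNorm T := by
  simp [hsNorm]

lemma hsNorm_mono [NormedAddCommGroup F] [NormedSpace ℝ F] {S : U →L[ℝ] E} {T : U →L[ℝ] F}
    (h : ∀ u, ‖S u‖ ≤ ‖T u‖) : hsNorm S ≤ hsNorm T := by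
  refine ENNReal.rpow_le_rpow (ENNReal.tsum_le_tsum fun i => ?_) one_half_pos.le
  gcongr
  exact enorm_le_iff_norm_le.2 (h _)

variable [CompleteSpace E]

lemma hsNorm_sq_eq_tsum (b : HilbertBasis ι ℝ U) (T : U →L[ℝ] E) :
    hsNorm T ^ 2 = ∑' i, ‖T (b i)‖ₑ ^ 2 := by
  rw [hsNorm_eq b, ← ENNReal.rpow_natCast, ← ENNReal.rpow_mul]
  norm_num

lemma hsNorm_add_sq_le (S T : U →L[ℝ] E) :
    hsNorm (S + T) ^ 2 ≤ 2 * hsNorm S ^ 2 + 2 * hsNorm T ^ 2 := by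
  obtain ⟨w, b, -⟩ := exists_hilbertBasis ℝ U
  simp only [hsNorm_sq_eq_tsum b, ← ENNReal.tsum_mul_left, ← ENNReal.tsum_add]
  exact ENNReal.tsum_le_tsum fun i => enorm_add_sq_le _ _

lemma hsNorm_sum_smulRight_sq [Fintype κ] (c : κ → ℝ) (u : κ → U) (y : κ → E) :
    hsNorm (∑ i, c i • (innerSL ℝ (u i)).smulRight (y i)) ^ 2
      = ENNReal.ofReal (∑ i, ∑ j, c i * c j * (⟪u i, u j⟫_ℝ * ⟪y i, y j⟫_ℝ)) := by
  obtain ⟨w, b, -⟩ := exists_hilbertBasis ℝ U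
  have hs := hasSum_norm_sum_smulRight_sq b c u y
  rw [hsNorm_sq_eq_tsum b, ← hs.tsum_eq,
    ENNReal.ofReal_tsum_of_nonneg (fun _ => sq_nonneg _) hs.summable]
  exact tsum_congr fun k => enorm_sq_eq_ofReal_norm_sq _

end HilbertSchmidt

section NoiseOperator

variable {U ι : Type*} [NormedAddCommGroup U] [InnerProductSpace ℝ U] [CompleteSpace U]
  {L : U →ₗ.[ℝ] U}

lemma norm_G_basis_sq (hL : IsAdmissible L) (e : Eigenbasis L ι) (i : ι) :
    ‖G hL (e.basis i)‖ ^ 2 = (e.eigenvalue i)⁻¹ := by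
  rw [H.norm_sq]
  change ‖(0 : U)‖ ^ 2 + ‖emb hL (e.basis i)‖ ^ 2 = _
  rw [← real_inner_self_eq_norm_sq (emb hL (e.basis i)),
    inner_emb_emb hL (hL.eigenvalue_pos e i).ne' (e.mem_eigenspace i),
    real_inner_self_eq_norm_sq, e.basis.orthonormal.norm_eq_one]
  simp

lemma hsNorm_G_ne_top (hL : IsAdmissible L) : hsNorm (G hL) ≠ ∞ := by
  obtain ⟨ι, ⟨e⟩⟩ := hL.exists_eigenbasis
  have hsq : hsNorm (G hL) ^ 2 = ENNReal.ofReal (∑' i, (e.eigenvalue i)⁻¹) := by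
    rw [hsNorm_sq_eq_tsum e.basis, ENNReal.ofReal_tsum_of_nonneg
      (fun i => inv_nonneg.2 (hL.eigenvalue_pos e i).le) (hL.summable_inv_eigenvalue e)]
    exact tsum_congr fun i => by rw [enorm_sq_eq_ofReal_norm_sq, norm_G_basis_sq hL e]
  intro htop
  simp [htop] at hsq

end NoiseOperator

/-! ### The Itô isometry -/

section ElementaryIntegrands

variable {U E Ω κ : Type*} [NormedAddCommGroup E] [NormedSpace ℝ E] [Fintype κ] {t : ℝ≥0}

/-- The elementary integrand `s ↦ ∑ i, 1_{(a i, b i]}(s) ⟪u i, ·⟫ y i` whose summands are indexed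
by an arbitrary finite type instead of some `Fin n`. -/
def Elementary.ofFintype {E : Type*} (a b : κ → ℝ≥0) (u : κ → U) (y : κ → E)
    (hab : ∀ i, a i ≤ b i) (hb : ∀ i, b i ≤ t) : Elementary U E t where
  n := Fintype.card κ
  a := a ∘ (Fintype.equivFin κ).symm
  b := b ∘ (Fintype.equivFin κ).symm
  u := u ∘ (Fintype.equivFin κ).symm
  y := y ∘ (Fintype.equivFin κ).symm
  a_le_b _ := hab _
  b_le _ := hb _

lemma Elementary.integral_ofFintype (a b : κ → ℝ≥0) (u : κ → U) (y : κ → E)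
    (hab : ∀ i, a i ≤ b i) (hb : ∀ i, b i ≤ t) (W : ℝ≥0 → U → Ω → ℝ) (ω : Ω) :
    (Elementary.ofFintype a b u y hab hb).integral W ω
      = ∑ i, (W (b i) (u i) ω - W (a i) (u i) ω) • y i :=
  (Fintype.equivFin κ).symm.sum_comp fun i => (W (b i) (u i) ω - W (a i) (u i) ω) • y i

/-- The difference of two elementary integrands. -/
def Elementary.sub (f g : Elementary U E t) : Elementary U E t :=
  Elementary.ofFintype (Sum.elim f.a g.a) (Sum.elim f.b g.b) (Sum.elim f.u g.u)
    (Sum.elim f.y fun i => -g.y i) (Sum.rec f.a_le_b g.a_le_b) (Sum.rec f.b_le g.b_le)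

lemma Elementary.integral_sub (f g : Elementary U E t) (W : ℝ≥0 → U → Ω → ℝ) (ω : Ω) :
    (f.sub g).integral W ω = f.integral W ω - g.integral W ω := by
  rw [Elementary.sub, Elementary.integral_ofFintype, Fintype.sum_sum_type]
  simp [Elementary.integral, sub_eq_add_neg]

variable [NormedAddCommGroup U] [InnerProductSpace ℝ U]

lemma Elementary.toFun_eq_sum_smul (f : Elementary U E t) (s : ℝ) :
    f.toFun s = ∑ i, (Ioc (f.a i : ℝ) (f.b i)).indicator (1 : ℝ → ℝ) s •
      (innerSL ℝ (f.u i)).smulRight (f.y i) :=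
  Finset.sum_congr rfl fun i _ => by
    simp only [indicator, Pi.one_apply, ite_smul, one_smul, zero_smul]

lemma Elementary.toFun_ofFintype (a b : κ → ℝ≥0) (u : κ → U) (y : κ → E)
    (hab : ∀ i, a i ≤ b i) (hb : ∀ i, b i ≤ t) (s : ℝ) :
    (Elementary.ofFintype a b u y hab hb).toFun s
      = ∑ i, (Ioc (a i : ℝ) (b i)).indicator (1 : ℝ → ℝ) s •
        (innerSL ℝ (u i)).smulRight (y i) := by
  rw [Elementary.toFun_eq_sum_smul]
  exact (Fintype.equivFin κ).symm.sum_comp fun i =>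
    (Ioc (a i : ℝ) (b i)).indicator (1 : ℝ → ℝ) s • (innerSL ℝ (u i)).smulRight (y i)

lemma Elementary.toFun_sub (f g : Elementary U E t) (s : ℝ) :
    (f.sub g).toFun s = f.toFun s - g.toFun s := by
  have hneg : ∀ (u : U) (y : E), (innerSL ℝ u).smulRight (-y) = -(innerSL ℝ u).smulRight y :=
    fun u y => by ext; simp
  rw [Elementary.sub, Elementary.toFun_ofFintype, Fintype.sum_sum_type,
    f.toFun_eq_sum_smul, g.toFun_eq_sum_smul]
  simp only [Sum.elim_inl, Sum.elim_inr, hneg, smul_neg, Finset.sum_neg_distrib, sub_eq_add_neg]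

end ElementaryIntegrands

section Isometry

variable {U E Ω : Type*} [NormedAddCommGroup U] [InnerProductSpace ℝ U] [MeasurableSpace Ω]
  {P : Measure Ω} {W : ℝ≥0 → U → Ω → ℝ} {t : ℝ≥0}

lemma lintegral_ofReal_sum_sum_mul {κ : Type*} [Fintype κ] {A : κ → κ → Ω → ℝ} {g : κ → κ → ℝ}
    (hA : ∀ i j, Integrable (A i j) P) (hnonneg : ∀ ω, 0 ≤ ∑ i, ∑ j, A i j ω * g i j) :
    ∫⁻ ω, ENNReal.ofReal (∑ i, ∑ j, A i j ω * g i j) ∂P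
      = ENNReal.ofReal (∑ i, ∑ j, (∫ ω, A i j ω ∂P) * g i j) := by
  have hint : ∀ i j, Integrable (fun ω => A i j ω * g i j) P := fun i j => (hA i j).mul_const _
  have hint' : ∀ i, Integrable (fun ω => ∑ j, A i j ω * g i j) P := fun i =>
    integrable_finsetSum _ fun j _ => hint i j
  rw [← ofReal_integral_eq_lintegral_ofReal (integrable_finsetSum _ fun i _ => hint' i)
    (Eventually.of_forall hnonneg), integral_finsetSum _ fun i _ => hint' i]
  simp only [integral_finsetSum _ fun j _ => hint _ j, integral_mul_const]

lemma eLpNorm_two_sq {F : Type*} [NormedAddCommGroup F] (X : Ω → F) :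
    eLpNorm X 2 P ^ 2 = ∫⁻ ω, ‖X ω‖ₑ ^ 2 ∂P := by
  simpa using eLpNorm_nnreal_pow_eq_lintegral (μ := P) (f := X) (p := 2) two_ne_zero

lemma IsCylindricalWiener.memLp_increment (hW : IsCylindricalWiener W P) (a b : ℝ≥0) (u : U) :
    MemLp (fun ω => W b u ω - W a u ω) 2 P :=
  (hW.gaussian.hasGaussianLaw_eval (b, u)).memLp_two.sub
    (hW.gaussian.hasGaussianLaw_eval (a, u)).memLp_two

lemma IsCylindricalWiener.covariance_increment (hW : IsCylindricalWiener W P)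
    (a b c d : ℝ≥0) (u v : U) :
    ∫ ω, (W b u ω - W a u ω) * (W d v ω - W c v ω) ∂P
      = (min (b : ℝ) d - min (b : ℝ) c - min (a : ℝ) d + min (a : ℝ) c) * ⟪u, v⟫_ℝ := by
  have hint : ∀ r s, Integrable (fun ω => W r u ω * W s v ω) P := fun r s =>
    (hW.gaussian.hasGaussianLaw_eval (r, u)).memLp_two.integrable_mul
      (hW.gaussian.hasGaussianLaw_eval (s, v)).memLp_two
  have hint_sub : ∀ s, Integrable (fun ω => W b u ω * W s v ω - W a u ω * W s v ω) P := fun s =>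
    (hint b s).sub (hint a s)
  simp only [sub_mul, mul_sub]
  rw [integral_sub (hint_sub d) (hint_sub c), integral_sub (hint b d) (hint a d),
    integral_sub (hint b c) (hint a c)]
  simp only [hW.covariance]
  ring

lemma integrable_indicator_Ioc_mul_indicator_Ioc {ν : Measure ℝ} [IsFiniteMeasure ν]
    (a b c d : ℝ) :
    Integrable (fun s => (Ioc a b).indicator (1 : ℝ → ℝ) s * (Ioc c d).indicator 1 s) ν := by
  change Integrable ((Ioc a b).indicator (1 : ℝ → ℝ) * (Ioc c d).indicator 1) ν
  rw [← inter_indicator_one]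
  exact (integrable_const 1).indicator (measurableSet_Ioc.inter measurableSet_Ioc)

lemma setIntegral_indicator_Ioc_mul_indicator_Ioc {a b c d T : ℝ} (ha : 0 ≤ a) (hab : a ≤ b)
    (hbT : b ≤ T) (hcd : c ≤ d) :
    ∫ s in Ioc 0 T, (Ioc a b).indicator (1 : ℝ → ℝ) s * (Ioc c d).indicator 1 s
      = min b d - min b c - min a d + min a c := by
  change ∫ s in Ioc 0 T, ((Ioc a b).indicator 1 * (Ioc c d).indicator 1 : ℝ → ℝ) s = _
  have hsub : Ioc a b ∩ Ioc c d ⊆ Ioc 0 T := fun s hs => ⟨ha.trans_lt hs.1.1, hs.1.2.trans hbT⟩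
  rw [← inter_indicator_one,
    integral_indicator_one (measurableSet_Ioc.inter measurableSet_Ioc),
    measureReal_restrict_apply (measurableSet_Ioc.inter measurableSet_Ioc),
    inter_eq_left.2 hsub, Ioc_inter_Ioc, Real.volume_real_Ioc]
  grind

lemma Elementary.memLp_integral [NormedAddCommGroup E] [NormedSpace ℝ E]
    (hW : IsCylindricalWiener W P) (f : Elementary U E t) : MemLp (f.integral W) 2 P :=
  memLp_finsetSum (f := fun i ω => (W (f.b i) (f.u i) ω - W (f.a i) (f.u i) ω) • f.y i) _
    fun i _ => (ContinuousLinearMap.toSpanSingleton ℝ (f.y i)).comp_memLp'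
      (hW.memLp_increment _ _ _)

variable [NormedAddCommGroup E] [InnerProductSpace ℝ E] [CompleteSpace U] [CompleteSpace E]

theorem Elementary.ito_isometry (hW : IsCylindricalWiener W P) (f : Elementary U E t) :
    eLpNorm (f.integral W) 2 P ^ 2 = ∫⁻ s in Ioc (0 : ℝ) t, hsNorm (f.toFun s) ^ 2 := by
  have hcov : ∀ i j, ∫ ω, (W (f.b i) (f.u i) ω - W (f.a i) (f.u i) ω)
        * (W (f.b j) (f.u j) ω - W (f.a j) (f.u j) ω) ∂P
      = (∫ s in Ioc (0 : ℝ) t, (Ioc (f.a i : ℝ) (f.b i)).indicator (1 : ℝ → ℝ) s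
        * (Ioc (f.a j : ℝ) (f.b j)).indicator 1 s) * ⟪f.u i, f.u j⟫_ℝ := fun i j => by
    rw [hW.covariance_increment, setIntegral_indicator_Ioc_mul_indicator_Ioc (f.a i).coe_nonneg
      (NNReal.coe_le_coe.2 (f.a_le_b i)) (NNReal.coe_le_coe.2 (f.b_le i))
      (NNReal.coe_le_coe.2 (f.a_le_b j))]
  have hind : ∀ i j, Integrable (fun s => (Ioc (f.a i : ℝ) (f.b i)).indicator (1 : ℝ → ℝ) s
      * (Ioc (f.a j : ℝ) (f.b j)).indicator 1 s) (volume.restrict (Ioc (0 : ℝ) t)) := fun i j =>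
    integrable_indicator_Ioc_mul_indicator_Ioc _ _ _ _
  have hint : ∀ i j, Integrable (fun ω => (W (f.b i) (f.u i) ω - W (f.a i) (f.u i) ω)
      * (W (f.b j) (f.u j) ω - W (f.a j) (f.u j) ω)) P := fun i j =>
    (hW.memLp_increment _ _ _).integrable_mul (hW.memLp_increment _ _ _)
  have hnonneg : ∀ c : Fin f.n → ℝ,
      0 ≤ ∑ i, ∑ j, c i * c j * (⟪f.u i, f.u j⟫_ℝ * ⟪f.y i, f.y j⟫_ℝ) := fun c => by
    obtain ⟨w, b, -⟩ := exists_hilbertBasis ℝ U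
    exact (hasSum_norm_sum_smulRight_sq b c f.u f.y).nonneg fun _ => sq_nonneg _
  simp only [f.toFun_eq_sum_smul, hsNorm_sum_smulRight_sq, eLpNorm_two_sq,
    enorm_sq_eq_ofReal_norm_sq, Elementary.integral, norm_sum_smul_sq]
  rw [lintegral_ofReal_sum_sum_mul hint
      (fun ω => (sq_nonneg _).trans_eq (norm_sum_smul_sq _ f.y)),
    lintegral_ofReal_sum_sum_mul hind fun s => hnonneg _]
  simp only [hcov, mul_assoc]

lemma Elementary.eLpNorm_integral_sub_sq (hW : IsCylindricalWiener W P)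
    (f g : Elementary U E t) :
    eLpNorm (fun ω => f.integral W ω - g.integral W ω) 2 P ^ 2
      = ∫⁻ s in Ioc (0 : ℝ) t, hsNorm (f.toFun s - g.toFun s) ^ 2 := by
  simp_rw [← Elementary.integral_sub, ← Elementary.toFun_sub]
  exact (f.sub g).ito_isometry hW

end Isometry

/-! ### Approximation by elementary integrands -/

section Partition

variable {E F : Type*} {a b : ℝ}

lemma exists_partition_dist_lt [PseudoMetricSpace F] {x : ℝ → F} (hab : a ≤ b)
    (hx : ContinuousOn x (Icc a b)) {δ : ℝ} (hδ : 0 < δ) :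
    ∃ τ : ℕ → ℝ, Monotone τ ∧ τ 0 = a ∧ (∃ n, τ n = b) ∧
      ∀ k, ∀ s ∈ Icc (τ k) (τ (k + 1)), dist (x (τ k)) (x s) < δ := by
  let c : Icc a b → Set (Icc a b) := fun r => (Icc a b).domRestrict x ⁻¹' Metric.ball (x r) (δ / 2)
  obtain ⟨τ, h0, hmono, ⟨n, hn⟩, hc⟩ := exists_monotone_Icc_subset_open_cover_Icc hab (c := c)
    (fun r => Metric.isOpen_ball.preimage (continuousOn_iff_continuous_domRestrict.1 hx))
    (fun r _ => mem_iUnion.2 ⟨r, Metric.mem_ball_self (half_pos hδ)⟩)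
  refine ⟨fun k => τ k, hmono, h0, ⟨n, hn n le_rfl⟩, fun k s hs => ?_⟩
  obtain ⟨r, hr⟩ := hc k
  have hτ : dist (x (τ k)) (x r) < δ / 2 := hr (left_mem_Icc.2 (hmono k.le_succ))
  have hs' : dist (x s) (x r) < δ / 2 :=
    @hr ⟨s, (τ k).2.1.trans hs.1, hs.2.trans (τ (k + 1)).2.2⟩ hs
  linarith [dist_triangle_right (x (τ k)) (x s) (x r)]

lemma sum_indicator_partition_smul [AddCommGroup E] [Module ℝ E] {τ : ℕ → ℝ} (hτ : Monotone τ)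
    {n k : ℕ} (hk : k < n) {s : ℝ} (hs : s ∈ Ioc (τ k) (τ (k + 1))) (y : ℕ → E) :
    ∑ j : Fin n, (Ioc (τ j) (τ (j + 1))).indicator (1 : ℝ → ℝ) s • y j = y k := by
  rw [Finset.sum_eq_single ⟨k, hk⟩ (fun j _ hj => ?_) (by simp)]
  · simp [hs]
  · have hdisj : Disjoint (Ioc (τ j) (τ (j + 1))) (Ioc (τ k) (τ (k + 1))) :=
      hτ.pairwise_disjoint_on_Ioc_succ fun h => hj (Fin.ext h)
    rw [indicator_of_notMem (fun hsj => disjoint_left.1 hdisj hsj hs), zero_smul]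

end Partition

section Approximation

variable {U E ι : Type*} [NormedAddCommGroup U] [InnerProductSpace ℝ U]

lemma exists_elementary_eq_on_partition [NormedAddCommGroup E] [NormedSpace ℝ E] {t : ℝ≥0}
    {κ : Type*} [Fintype κ] (u : κ → U) (y : κ → ℝ → E) {τ : ℕ → ℝ} (hτ : Monotone τ)
    (hτ0 : τ 0 = 0) {n : ℕ} (hτn : τ n = t) :
    ∃ f : Elementary U E t, ∀ k < n, ∀ s ∈ Ioc (τ k) (τ (k + 1)),
      f.toFun s = ∑ i, (innerSL ℝ (u i)).smulRight (y i (τ k)) := by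
  have hnonneg : ∀ k, 0 ≤ τ k := fun k => hτ0 ▸ hτ k.zero_le
  let σ : ℕ → ℝ≥0 := fun k => ⟨τ k, hnonneg k⟩
  have hσ : ∀ k < n, σ (k + 1) ≤ t := fun k hk => NNReal.coe_le_coe.1 ((hτ hk).trans_eq hτn)
  refine ⟨Elementary.ofFintype (κ := κ × Fin n) (fun p => σ p.2) (fun p => σ (p.2 + 1))
    (fun p => u p.1) (fun p => y p.1 (τ p.2)) (fun p => NNReal.coe_le_coe.1 (hτ (Nat.le_succ _)))
    (fun p => hσ _ p.2.2), fun k hk s hs => ?_⟩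
  rw [Elementary.toFun_ofFintype, Fintype.sum_prod_type]
  exact Finset.sum_congr rfl fun i _ =>
    sum_indicator_partition_smul hτ hk hs fun j => (innerSL ℝ (u i)).smulRight (y i (τ j))

/-- The finite-rank operator that agrees with `T` on the basis vectors `b i`, `i ∈ s`, and
vanishes on the others. -/
def truncate [NormedAddCommGroup E] [NormedSpace ℝ E] (b : HilbertBasis ι ℝ U) (s : Finset ι)
    (T : U →L[ℝ] E) : U →L[ℝ] E :=
  ∑ i : s, (innerSL ℝ (b i)).smulRight (T (b i))

lemma truncate_apply_basis [DecidableEq ι] [NormedAddCommGroup E] [NormedSpace ℝ E]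
    (b : HilbertBasis ι ℝ U) (s : Finset ι) (T : U →L[ℝ] E) (i : ι) :
    truncate b s T (b i) = if i ∈ s then T (b i) else 0 := by
  simp only [truncate, sum_apply, ContinuousLinearMap.smulRight_apply, innerSL_apply_apply,
    orthonormal_iff_ite.1 b.orthonormal, ite_smul, one_smul, zero_smul]
  rw [Finset.sum_coe_sort s fun j => if j = i then T (b j) else 0, Finset.sum_ite_eq']

variable [NormedAddCommGroup E] [InnerProductSpace ℝ E] [CompleteSpace U] [CompleteSpace E]

lemma hsNorm_truncate_sub_sq (b : HilbertBasis ι ℝ U) (s : Finset ι) (S T : U →L[ℝ] E) :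
    hsNorm (truncate b s S - T) ^ 2
      = ∑ i ∈ s, ‖S (b i) - T (b i)‖ₑ ^ 2 + ∑' i : ((s : Set ι)ᶜ : Set ι), ‖T (b i)‖ₑ ^ 2 := by
  classical
  rw [hsNorm_sq_eq_tsum b, ← ENNReal.sum_add_tsum_compl s]
  congr 1
  · exact Finset.sum_congr rfl fun i hi => by rw [sub_apply, truncate_apply_basis, if_pos hi]
  · exact tsum_congr fun i => by
      rw [sub_apply, truncate_apply_basis, if_neg (fun h => i.2 (Finset.mem_coe.2 h)), zero_sub,
        enorm_neg]

lemma hsNorm_truncate_sub_sq_le (b : HilbertBasis ι ℝ U) (s : Finset ι) {R S T : U →L[ℝ] E}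
    {δ : ℝ} (hdist : ∀ i ∈ s, dist (R (b i)) (S (b i)) ≤ δ) (hle : ∀ u, ‖S u‖ ≤ ‖T u‖) :
    hsNorm (truncate b s R - S) ^ 2
      ≤ s.card * ENNReal.ofReal (δ ^ 2) + ∑' i : ((s : Set ι)ᶜ : Set ι), ‖T (b i)‖ₑ ^ 2 := by
  rw [hsNorm_truncate_sub_sq, ← nsmul_eq_mul]
  gcongr with i
  · refine Finset.sum_le_card_nsmul s _ _ fun i hi => ?_
    rw [enorm_sq_eq_ofReal_norm_sq, ← dist_eq_norm]
    gcongr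
    exact hdist i hi
  · exact enorm_le_iff_norm_le.2 (hle _)

lemma exists_pos_natCast_mul_ofReal_sq_le (m : ℕ) {ε : ℝ≥0∞} (hε : ε ≠ 0) :
    ∃ δ : ℝ, 0 < δ ∧ m * ENNReal.ofReal (δ ^ 2) ≤ ε := by
  have hlim : Tendsto (fun δ : ℝ => m * ENNReal.ofReal (δ ^ 2)) (𝓝[>] 0) (𝓝 0) := by
    refine tendsto_nhdsWithin_of_tendsto_nhds (Continuous.tendsto' ?_ _ _ (by simp))
    exact (ENNReal.continuous_const_mul (ENNReal.natCast_ne_top _)).comp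
      (ENNReal.continuous_ofReal.comp (continuous_pow 2))
  exact (eventually_mem_nhdsWithin.and
    (hlim.eventually_le_const (pos_iff_ne_zero.2 hε))).exists

variable {t : ℝ≥0} {Φ : ℝ → U →L[ℝ] E} {T : U →L[ℝ] E}

lemma exists_elementary_hsNorm_sub_sq_le (hΦ : ∀ u, ContinuousOn (fun s => Φ s u) (Icc 0 t))
    (hT : hsNorm T ≠ ∞) (hle : ∀ s ∈ Icc (0 : ℝ) t, ∀ u, ‖Φ s u‖ ≤ ‖T u‖) {ε : ℝ≥0∞}
    (hε : ε ≠ 0) :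
    ∃ f : Elementary U E t, ∀ s ∈ Ioc (0 : ℝ) t, hsNorm (f.toFun s - Φ s) ^ 2 ≤ ε := by
  obtain ⟨w, b, -⟩ := exists_hilbertBasis ℝ U
  have hTsum : ∑' i, ‖T (b i)‖ₑ ^ 2 ≠ ∞ := by
    rw [← hsNorm_sq_eq_tsum b]
    exact ENNReal.pow_ne_top hT
  obtain ⟨s, hs⟩ := ((ENNReal.tendsto_tsum_compl_atTop_zero hTsum).eventually_lt_const
    (ENNReal.half_pos hε)).exists
  obtain ⟨δ, hδ, hδε⟩ := exists_pos_natCast_mul_ofReal_sq_le s.card (ENNReal.half_pos hε).ne'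
  obtain ⟨τ, hτ, hτ0, ⟨n, hτn⟩, hdist⟩ := exists_partition_dist_lt (x := fun r (i : s) => Φ r (b i))
    t.coe_nonneg (continuousOn_pi.2 fun i => hΦ _) hδ
  obtain ⟨f, hf⟩ := exists_elementary_eq_on_partition (fun i : s => b i)
    (fun i r => Φ r (b i)) hτ hτ0 hτn
  refine ⟨f, fun r hr => ?_⟩
  obtain ⟨k, hk, hrk⟩ : ∃ k < n, r ∈ Ioc (τ k) (τ (k + 1)) := by
    rw [← hτ0, ← hτn, ← hτ.biUnion_Ico_Ioc_map_succ] at hr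
    simpa [and_left_comm] using hr
  have hdist : ∀ i ∈ s, dist (Φ (τ k) (b i)) (Φ r (b i)) ≤ δ := fun i hi =>
    (dist_le_pi_dist (fun i : s => Φ (τ k) (b i)) (fun i : s => Φ r (b i)) ⟨i, hi⟩).trans
      (hdist k r (Ioc_subset_Icc_self hrk)).le
  calc hsNorm (f.toFun r - Φ r) ^ 2 = hsNorm (truncate b s (Φ (τ k)) - Φ r) ^ 2 := by
        rw [hf k hk r hrk, truncate]
    _ ≤ s.card * ENNReal.ofReal (δ ^ 2) + ∑' i : ((s : Set w)ᶜ : Set w), ‖T (b i)‖ₑ ^ 2 :=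
        hsNorm_truncate_sub_sq_le b s hdist (hle r (Ioc_subset_Icc_self hr))
    _ ≤ ε := (add_le_add hδε hs.le).trans_eq (ENNReal.add_halves ε)

end Approximation

/-! ### The stochastic integral -/

section StochasticIntegral

variable {U E Ω : Type*} [NormedAddCommGroup U] [InnerProductSpace ℝ U]

lemma countable_of_orthonormal {ι : Type*} [TopologicalSpace.SeparableSpace U] {v : ι → U}
    (hv : Orthonormal ℝ v) : Countable ι := by
  refine Pairwise.countable_of_isOpen_disjoint (s := fun i => Metric.ball (v i) (1 / 2))
    (fun i j hij => Metric.ball_disjoint_ball ?_) (fun _ => Metric.isOpen_ball)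
    fun i => Metric.nonempty_ball.2 one_half_pos
  have hsq : ‖v i - v j‖ ^ 2 = 2 := by
    rw [norm_sub_sq_real, hv.inner_eq_zero hij, hv.norm_eq_one, hv.norm_eq_one]
    norm_num
  rw [dist_eq_norm]
  nlinarith [norm_nonneg (v i - v j)]

variable [CompleteSpace U] [NormedAddCommGroup E] [InnerProductSpace ℝ E] [CompleteSpace E]
  {t : ℝ≥0} {Φ : ℝ → U →L[ℝ] E}

lemma exists_tendsto_lintegral_hsNorm_sub_sq {T : U →L[ℝ] E}
    (hΦ : ∀ u, ContinuousOn (fun s => Φ s u) (Icc 0 t)) (hT : hsNorm T ≠ ∞)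
    (hle : ∀ s ∈ Icc (0 : ℝ) t, ∀ u, ‖Φ s u‖ ≤ ‖T u‖) :
    ∃ f : ℕ → Elementary U E t,
      Tendsto (fun n => ∫⁻ s in Ioc (0 : ℝ) t, hsNorm ((f n).toFun s - Φ s) ^ 2) atTop
        (𝓝 0) := by
  choose f hf using fun n : ℕ => exists_elementary_hsNorm_sub_sq_le hΦ hT hle
    (ENNReal.inv_ne_zero.2 (ENNReal.natCast_ne_top n))
  have hlim : Tendsto (fun n : ℕ => (n : ℝ≥0∞)⁻¹ * volume (Ioc (0 : ℝ) t)) atTop (𝓝 0) := by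
    simpa using ENNReal.Tendsto.mul_const ENNReal.tendsto_inv_nat_nhds_zero
      (Or.inr (measure_Ioc_lt_top (μ := volume) (a := (0 : ℝ)) (b := t)).ne)
  refine ⟨f, tendsto_of_tendsto_of_tendsto_of_le_of_le tendsto_const_nhds hlim
    (fun _ => zero_le) fun n => ?_⟩
  exact (setLIntegral_mono' measurableSet_Ioc (hf n)).trans_eq (setLIntegral_const _ _)

variable [TopologicalSpace.SeparableSpace U]

lemma Elementary.aemeasurable_hsNorm_sub_sq
    (hΦ : ∀ u, AEStronglyMeasurable (fun s => Φ s u) (volume.restrict (Ioc (0 : ℝ) t)))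
    (f : Elementary U E t) :
    AEMeasurable (fun s => hsNorm (f.toFun s - Φ s) ^ 2) (volume.restrict (Ioc (0 : ℝ) t)) := by
  obtain ⟨w, b, -⟩ := exists_hilbertBasis ℝ U
  have : Countable w := countable_of_orthonormal b.orthonormal
  have hf : StronglyMeasurable f.toFun :=
    Finset.stronglyMeasurable_fun_sum _ fun i _ =>
      stronglyMeasurable_const.indicator measurableSet_Ioc
  simp only [hsNorm_sq_eq_tsum b]
  exact AEMeasurable.tsum fun i => ((AEStronglyMeasurable.sub
    ((ContinuousLinearMap.apply ℝ E (b i)).continuous.comp_stronglyMeasurable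
      hf).aestronglyMeasurable (hΦ (b i))).enorm).pow_const 2

lemma Elementary.lintegral_hsNorm_sub_sq_le
    (hΦ : ∀ u, AEStronglyMeasurable (fun s => Φ s u) (volume.restrict (Ioc (0 : ℝ) t)))
    (f g : Elementary U E t) :
    ∫⁻ s in Ioc (0 : ℝ) t, hsNorm (f.toFun s - g.toFun s) ^ 2
      ≤ 2 * (∫⁻ s in Ioc (0 : ℝ) t, hsNorm (f.toFun s - Φ s) ^ 2)
        + 2 * ∫⁻ s in Ioc (0 : ℝ) t, hsNorm (g.toFun s - Φ s) ^ 2 := by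
  rw [← lintegral_const_mul'' _ (f.aemeasurable_hsNorm_sub_sq hΦ),
    ← lintegral_const_mul'' _ (g.aemeasurable_hsNorm_sub_sq hΦ),
    ← lintegral_add_left' ((f.aemeasurable_hsNorm_sub_sq hΦ).const_mul _)]
  refine lintegral_mono fun s => ?_
  have h := hsNorm_add_sq_le (f.toFun s - Φ s) (-(g.toFun s - Φ s))
  rwa [hsNorm_neg, ← sub_eq_add_neg, sub_sub_sub_cancel_right] at h

variable [MeasurableSpace Ω] {P : Measure Ω} {W : ℝ≥0 → U → Ω → ℝ}

lemma Elementary.tendsto_eLpNorm_integral_sub {κ : Type*} {l : Filter κ}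
    (hW : IsCylindricalWiener W P)
    (hΦ : ∀ u, AEStronglyMeasurable (fun s => Φ s u) (volume.restrict (Ioc (0 : ℝ) t)))
    {f g : κ → Elementary U E t}
    (hf : Tendsto (fun k => ∫⁻ s in Ioc (0 : ℝ) t, hsNorm ((f k).toFun s - Φ s) ^ 2) l (𝓝 0))
    (hg : Tendsto (fun k => ∫⁻ s in Ioc (0 : ℝ) t, hsNorm ((g k).toFun s - Φ s) ^ 2) l (𝓝 0)) :
    Tendsto (fun k => eLpNorm (fun ω => (f k).integral W ω - (g k).integral W ω) 2 P) l
      (𝓝 0) := by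
  have hbound := (ENNReal.Tendsto.const_mul hf (Or.inr ENNReal.ofNat_ne_top) (a := 2)).add
    (ENNReal.Tendsto.const_mul hg (Or.inr ENNReal.ofNat_ne_top) (a := 2))
  rw [mul_zero, add_zero] at hbound
  have hsq : Tendsto
      (fun k => eLpNorm (fun ω => (f k).integral W ω - (g k).integral W ω) 2 P ^ 2) l (𝓝 0) :=
    tendsto_of_tendsto_of_tendsto_of_le_of_le tendsto_const_nhds hbound (fun _ => zero_le)
      fun k => (eLpNorm_integral_sub_sq hW (f k) (g k)).trans_le
        (lintegral_hsNorm_sub_sq_le hΦ (f k) (g k))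
  have hroot := hsq.ennrpow_const (1 / 2)
  rw [ENNReal.zero_rpow_of_pos one_half_pos] at hroot
  refine hroot.congr fun k => ?_
  rw [← ENNReal.rpow_natCast, ← ENNReal.rpow_mul]
  norm_num

lemma IsStochasticIntegral.ae_eq {X Y : Ω → E} (hW : IsCylindricalWiener W P)
    (hΦ : ∀ u, AEStronglyMeasurable (fun s => Φ s u) (volume.restrict (Ioc (0 : ℝ) t)))
    (hX : IsStochasticIntegral W P t Φ X) (hY : IsStochasticIntegral W P t Φ Y) : Y =ᵐ[P] X := by
  obtain ⟨hX2, f, hf, hfX⟩ := hX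
  obtain ⟨hY2, g, hg, hgY⟩ := hY
  have hmem (f : Elementary U E t) := f.memLp_integral hW
  have hlimX := (Lp.tendsto_Lp_iff_tendsto_eLpNorm'' _ (fun n => hmem (f n)) X hX2).2 hfX
  have hlimY := (Lp.tendsto_Lp_iff_tendsto_eLpNorm'' _ (fun n => hmem (g n)) Y hY2).2 hgY
  have hfg : Tendsto (fun n => eLpNorm ((f n).integral W - (g n).integral W - 0) 2 P) atTop
      (𝓝 0) := by
    simp only [sub_zero]
    exact Elementary.tendsto_eLpNorm_integral_sub hW hΦ hf hg
  have hlim := (Lp.tendsto_Lp_iff_tendsto_eLpNorm'' _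
    (fun n => (hmem (f n)).sub (hmem (g n))) 0 MemLp.zero).2 hfg
  have heq : hX2.toLp X - hY2.toLp Y = 0 := tendsto_nhds_unique (hlimX.sub hlimY) hlim
  exact ((MemLp.toLp_eq_toLp_iff hX2 hY2).1 (sub_eq_zero.1 heq)).symm

lemma exists_isStochasticIntegral_of_tendsto (hW : IsCylindricalWiener W P)
    (hΦ : ∀ u, AEStronglyMeasurable (fun s => Φ s u) (volume.restrict (Ioc (0 : ℝ) t)))
    {f : ℕ → Elementary U E t}
    (hf : Tendsto (fun n => ∫⁻ s in Ioc (0 : ℝ) t, hsNorm ((f n).toFun s - Φ s) ^ 2) atTop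
      (𝓝 0)) : ∃ X : Ω → E, IsStochasticIntegral W P t Φ X := by
  have hcauchy : CauchySeq fun n => ((f n).memLp_integral hW).toLp := by
    rw [Lp.cauchySeq_Lp_iff_cauchySeq_eLpNorm, ← prod_atTop_atTop_eq]
    refine (Elementary.tendsto_eLpNorm_integral_sub hW hΦ (hf.comp tendsto_fst)
      (hf.comp tendsto_snd)).congr fun n => eLpNorm_congr_ae ?_
    exact ((MemLp.coeFn_toLp _).sub (MemLp.coeFn_toLp _)).symm
  obtain ⟨X, hX⟩ := cauchySeq_tendsto_of_complete hcauchy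
  refine ⟨X, Lp.memLp X, f, hf, (Lp.tendsto_Lp_iff_tendsto_eLpNorm'' _
    (fun n => (f n).memLp_integral hW) X (Lp.memLp X)).1 ?_⟩
  rwa [Lp.toLp_coeFn]

end StochasticIntegral

/-! ### Stochastic convolutions -/

section StochasticConvolution

lemma lintegral_rpow_lt_top (T : ℝ) {γ : ℝ} (hγ : γ < 1 / 2) :
    ∫⁻ t in Ioc (0 : ℝ) T, ENNReal.ofReal (t ^ (-2 * γ)) < ∞ := by
  have hint : IntegrableOn (fun t : ℝ => t ^ (-2 * γ)) (Ioc 0 T) :=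
    (intervalIntegral.intervalIntegrable_rpow' (by linarith)).1
  exact hint.lintegral_lt_top

variable {U E : Type*} [NormedAddCommGroup U] [InnerProductSpace ℝ U] [CompleteSpace U]
  [NormedAddCommGroup E] [InnerProductSpace ℝ E] {S : ℝ → E →L[ℝ] E} {B : U →L[ℝ] E}

lemma iSup_hsNorm_comp_lt_top (hcontr : ∀ t, 0 ≤ t → ∀ x, ‖S t x‖ ≤ ‖x‖)
    (hB : hsNorm B ≠ ∞) : ⨆ t ∈ Ici (0 : ℝ), hsNorm ((S t).comp B) < ∞ :=
  (iSup₂_le fun t ht => hsNorm_mono fun u => hcontr t ht (B u)).trans_lt hB.lt_top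

lemma lintegral_rpow_mul_hsNorm_comp_sq_lt_top (hcontr : ∀ t, 0 ≤ t → ∀ x, ‖S t x‖ ≤ ‖x‖)
    (hB : hsNorm B ≠ ∞) (T : ℝ) {γ : ℝ} (hγ : γ < 1 / 2) :
    ∫⁻ t in Ioc (0 : ℝ) T, ENNReal.ofReal (t ^ (-2 * γ)) * hsNorm ((S t).comp B) ^ 2 < ∞ :=
  calc ∫⁻ t in Ioc (0 : ℝ) T, ENNReal.ofReal (t ^ (-2 * γ)) * hsNorm ((S t).comp B) ^ 2
      ≤ ∫⁻ t in Ioc (0 : ℝ) T, ENNReal.ofReal (t ^ (-2 * γ)) * hsNorm B ^ 2 :=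
        setLIntegral_mono' measurableSet_Ioc fun t ht => by
          gcongr
          exact hsNorm_mono fun u => hcontr t ht.1.le (B u)
    _ = (∫⁻ t in Ioc (0 : ℝ) T, ENNReal.ofReal (t ^ (-2 * γ))) * hsNorm B ^ 2 :=
        lintegral_mul_const' _ _ (ENNReal.pow_ne_top hB)
    _ < ∞ := ENNReal.mul_lt_top (lintegral_rpow_lt_top T hγ) (ENNReal.pow_lt_top hB.lt_top)

theorem exists_stochasticConvolution [TopologicalSpace.SeparableSpace U] [CompleteSpace E]
    {Ω : Type*} [MeasurableSpace Ω] {P : Measure Ω} {W : ℝ≥0 → U → Ω → ℝ}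
    (hS : IsC0Semigroup S) (hcontr : ∀ t, 0 ≤ t → ∀ x, ‖S t x‖ ≤ ‖x‖) (hB : hsNorm B ≠ ∞)
    (hW : IsCylindricalWiener W P) (t : ℝ≥0) :
    ∃ X : Ω → E, IsStochasticIntegral W P t (fun s => (S (t - s)).comp B) X ∧
      ∀ Y : Ω → E, IsStochasticIntegral W P t (fun s => (S (t - s)).comp B) Y → Y =ᵐ[P] X := by
  have hcont : ∀ u, ContinuousOn (fun s => (S (t - s)).comp B u) (Icc (0 : ℝ) t) := fun u =>
    (hS.continuousOn (B u)).comp (by fun_prop) fun s hs => sub_nonneg.2 hs.2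
  have hmeas : ∀ u, AEStronglyMeasurable (fun s => (S (t - s)).comp B u)
      (volume.restrict (Ioc (0 : ℝ) t)) := fun u =>
    ((hcont u).mono Ioc_subset_Icc_self).aestronglyMeasurable measurableSet_Ioc
  obtain ⟨f, hf⟩ := exists_tendsto_lintegral_hsNorm_sub_sq hcont hB
    fun s hs u => hcontr (t - s) (sub_nonneg.2 hs.2) (B u)
  obtain ⟨X, hX⟩ := exists_isStochasticIntegral_of_tendsto hW hmeas hf
  exact ⟨X, hX, fun Y hY => hX.ae_eq hW hmeas hY⟩

end StochasticConvolution

end DampedWave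

end

theorem mainTheorem7_general {U : Type*} [NormedAddCommGroup U] [InnerProductSpace ℝ U]
    [CompleteSpace U] [TopologicalSpace.SeparableSpace U] (Λ : U →ₗ.[ℝ] U)
    (hΛ : DampedWave.IsAdmissible Λ) {ρ : ℝ} (α : ℝ) (hρ : 0 ≤ ρ) :
    (∃ S : ℝ → DampedWave.H hΛ →L[ℝ] DampedWave.H hΛ,
      DampedWave.Generates (DampedWave.waveOp hΛ α ρ) S) ∧
    ∀ S : ℝ → DampedWave.H hΛ →L[ℝ] DampedWave.H hΛ,
      DampedWave.Generates (DampedWave.waveOp hΛ α ρ) S →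
        (⨆ t ∈ Set.Ici (0 : ℝ), DampedWave.hsNorm ((S t).comp (DampedWave.G hΛ))) < ∞ ∧
        (∀ T γ : ℝ, γ < 1 / 2 →
          ∫⁻ t in Set.Ioc (0 : ℝ) T, ENNReal.ofReal (t ^ (-2 * γ)) *
            DampedWave.hsNorm ((S t).comp (DampedWave.G hΛ)) ^ 2 < ∞) ∧
        ∀ (Ω : Type*) [MeasurableSpace Ω] (P : Measure Ω) (W : ℝ≥0 → U → Ω → ℝ),
          DampedWave.IsCylindricalWiener W P →
          ∀ t : ℝ≥0, ∃ X : Ω → DampedWave.H hΛ,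
            DampedWave.IsStochasticIntegral W P t
              (fun s => (S (t - s)).comp (DampedWave.G hΛ)) X ∧
            ∀ Y : Ω → DampedWave.H hΛ,
              DampedWave.IsStochasticIntegral W P t
                (fun s => (S (t - s)).comp (DampedWave.G hΛ)) Y → Y =ᵐ[P] X := by
  refine ⟨DampedWave.exists_generates_waveOp hΛ hρ, fun S hS => ?_⟩
  have hcontr : ∀ t, 0 ≤ t → ∀ x, ‖S t x‖ ≤ ‖x‖ := fun t ht x =>
    DampedWave.norm_apply_le_of_generates_waveOp hΛ hρ hS ht x
  have hG : DampedWave.hsNorm (DampedWave.G hΛ) ≠ ∞ := DampedWave.hsNorm_G_ne_top hΛ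
  exact ⟨DampedWave.iSup_hsNorm_comp_lt_top hcontr hG,
    fun T _ hγ => DampedWave.lintegral_rpow_mul_hsNorm_comp_sq_lt_top hcontr hG T hγ,
    fun _ _ _ _ hW t => DampedWave.exists_stochasticConvolution hS.1 hcontr hG hW t⟩

theorem mainTheorem7 {U : Type*} [NormedAddCommGroup U] [InnerProductSpace ℝ U] [CompleteSpace U]
    [TopologicalSpace.SeparableSpace U] (Λ : U →ₗ.[ℝ] U) (hΛ : DampedWave.IsAdmissible Λ)
    (ρ α : ℝ) (hρ : 0 < ρ) (hα₀ : 0 ≤ α) (hα₁ : α < 1)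
    (hne : ∀ m : ℝ, DampedWave.IsEigenvalue Λ m → ρ ^ 2 ≠ 4 * m ^ (1 - 2 * α)) :
    (∃ S : ℝ → DampedWave.H hΛ →L[ℝ] DampedWave.H hΛ,
      DampedWave.Generates (DampedWave.waveOp hΛ α ρ) S) ∧
    ∀ S : ℝ → DampedWave.H hΛ →L[ℝ] DampedWave.H hΛ,
      DampedWave.Generates (DampedWave.waveOp hΛ α ρ) S →
        (⨆ t ∈ Set.Ici (0 : ℝ), DampedWave.hsNorm ((S t).comp (DampedWave.G hΛ))) < ∞ ∧
        (∀ T : ℝ, 0 < T → ∀ γ ∈ Set.Ioo (0 : ℝ) (1 / 2),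
          ∫⁻ t in Set.Ioc (0 : ℝ) T, ENNReal.ofReal (t ^ (-2 * γ)) *
            DampedWave.hsNorm ((S t).comp (DampedWave.G hΛ)) ^ 2 < ∞) ∧
        ∀ (Ω : Type*) [MeasurableSpace Ω] (P : Measure Ω) [IsProbabilityMeasure P]
          (W : ℝ≥0 → U → Ω → ℝ), DampedWave.IsCylindricalWiener W P →
          ∀ t : ℝ≥0, ∃ X : Ω → DampedWave.H hΛ,
            DampedWave.IsStochasticIntegral W P t
              (fun s => (S (t - s)).comp (DampedWave.G hΛ)) X ∧
            ∀ Y : Ω → DampedWave.H hΛ,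
              DampedWave.IsStochasticIntegral W P t
                (fun s => (S (t - s)).comp (DampedWave.G hΛ)) Y → Y =ᵐ[P] X := by
  obtain ⟨hex, hreg⟩ := mainTheorem7_general Λ hΛ α hρ.le
  exact ⟨hex, fun S hS => (hreg S hS).imp_right fun ⟨hint, hconv⟩ =>
    ⟨fun T _ γ hγ => hint T γ hγ.2, fun Ω _ P _ => hconv Ω P⟩⟩
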